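/- Let $\mathcal H_1,\dots,\mathcal H_N$ ($N=2$ or $3$) be complex separable Hilbert spaces with dimensions $d_n=\dim\mathcal H_n\in\{1,2,\dots\}\cup\{\infty\}$, let $\rho$ be a state (a positive trace class operator of trace one) on $\mathcal H_1\otimes\cdots\otimes\mathcal H_N$, and let $S_1,\dots,S_N\ge 1$ be integers. Given standard measurable spaces $\Lambda_1,\dots,\Lambda_N$ and normalized positive operator-valued measures $\mathrm M_n^{(s_n)}$ on $\Lambda_n$ with values in the bounded operators on $\mathcal H_n$ ($s_n=1,\dots,S_n$, $n=1,\dots,N$), let $\gamma$ be the infimum of the total variation norms of all bounded real-valued (signed) measures $\mu$ on $\Lambda_1^{S_1}\times\cdots\times\Lambda_N^{S_N}$ of total mass one whose marginals are the joint distributions $\mathrm{tr}[\rho\{\mathrm M_1^{(s_1)}(\mathrm d\lambda_1)\otimes\cdots\otimes\mathrm M_N^{(s_N)}(\mathrm d\lambda_N)\}]$, for all $s_1,\dots,s_N$. Let $\Upsilon^{(\rho)}_{S_1\times\cdots\times S_N}$ (the maximal $S_1\times\cdots\times S_N$-setting Bell violation of $\rho$) be the supremum of $\gamma$ over all outcome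 spaces $\Lambda_n$ and all such families of positive operator-valued measures. (i) For every bipartite state $\rho$ and all integers $S_1,S_2\ge1$, $$\Upsilon^{(\rho)}_{S_1\times S_2}\le 2\min\{S_1,S_2,d_1,d_2\}-1 .$$ In particular, if $d_1=d_2=d$ and $S_1=S_2=S$, then $\Upsilon^{(\rho)}_{S\times S}\le 2\min\{S,d\}-1$. (ii) For every tripartite state $\rho$ and all integers $S_1,S_2,S_3\ge1$, $$\Upsilon^{(\rho)}_{S_1\times S_2\times S_3}\le\min\Big\{\min_{\{n_1,n_2\}\subset\{1,2,3\}}\big(4S_{n_1}S_{n_2}-2(S_{n_1}+S_{n_2})+1\big),\ 4\,\frac{d_1d_2d_3}{\max_n d_n}-3\Big\}\le 4\min\Big\{\frac{S_1S_2S_3}{\max_n S_n},\frac{d_1d_2d_3}{\max_n d_n}\Big\}-3,$$ where $n_1\ne n_2$, and where $d_1d_2d_3/\max_n d_n$ is understood as the product of the two smallest of the numbers $d_1,d_2,d_3$ also when some of them are infinite. In particular, if $d_1=d_2=d_3=d$ and $S_1=S_2=S_3=S$, then $$\Upsilon^{(\rho)}_{S\times S\times S}\le\min\{(2S-1)^2,\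 4d^2-3\}\le 4(\min\{S,d\})^2-3 .$$ -/

import Mathlib

open MeasureTheory Set
open scoped TensorProduct ENNReal

noncomputable section

/-! ### Hilbert spaces -/

/-- The Hilbert space tensor product of two complex Hilbert spaces: the completion of the algebraic
tensor product with respect to `⟪x ⊗ y, x' ⊗ y'⟫ = ⟪x, x'⟫ * ⟪y, y'⟫`. -/
abbrev HilbertTensor (H K : Type*) [NormedAddCommGroup H] [InnerProductSpace ℂ H]
    [NormedAddCommGroup K] [InnerProductSpace ℂ K] : Type _ :=
  UniformSpace.Completion (H ⊗[ℂ] K)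

/-- The bounded operator `X ⊗ Y` on the Hilbert space tensor product. -/
def opTensor {H K : Type*} [NormedAddCommGroup H] [InnerProductSpace ℂ H]
    [NormedAddCommGroup K] [InnerProductSpace ℂ K] (X : H →L[ℂ] H) (Y : K →L[ℂ] K) :
    HilbertTensor H K →L[ℂ] HilbertTensor H K :=
  (TensorProduct.mapL X Y).completion

theorem opTensor_tmul {H K : Type*} [NormedAddCommGroup H] [InnerProductSpace ℂ H]
    [NormedAddCommGroup K] [InnerProductSpace ℂ K] (X : H →L[ℂ] H) (Y : K →L[ℂ] K)
    (x : H) (y : K) :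
    opTensor X Y ((x ⊗ₜ[ℂ] y : H ⊗[ℂ] K) : HilbertTensor H K)
      = ((X x ⊗ₜ[ℂ] Y y : H ⊗[ℂ] K) : HilbertTensor H K) := by
  simp [opTensor]

/-- The Hilbert space dimension, with value `⊤` for infinite-dimensional spaces. -/
def hilbertDim (H : Type*) [NormedAddCommGroup H] [InnerProductSpace ℂ H] : ℕ∞ :=
  Cardinal.toENat (Module.rank ℂ H)

/-- A fixed orthonormal (Hilbert) basis of a Hilbert space. -/
def stdBasis (K : Type*) [NormedAddCommGroup K] [InnerProductSpace ℂ K] [CompleteSpace K] :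
    HilbertBasis (exists_hilbertBasis ℂ K).choose ℂ K :=
  (exists_hilbertBasis ℂ K).choose_spec.choose

/-- The trace `tr T = ∑ i, ⟪e i, T (e i)⟫` (meant for trace class operators, for which the series
converges absolutely and the choice of the orthonormal basis `e` is irrelevant). -/
def opTrace {K : Type*} [NormedAddCommGroup K] [InnerProductSpace ℂ K] [CompleteSpace K]
    (T : K →L[ℂ] K) : ℂ :=
  ∑' i, inner ℂ (stdBasis K i) (T (stdBasis K i))

/-- A quantum state on `K`: a positive trace class operator of trace one. (A positive operator is
trace class iff the series of its diagonal matrix elements in an orthonormal basis converges.) -/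
structure IsState {K : Type*} [NormedAddCommGroup K] [InnerProductSpace ℂ K] [CompleteSpace K]
    (ρ : K →L[ℂ] K) : Prop where
  positive : ρ.IsPositive
  summable : Summable fun i => inner ℂ (stdBasis K i) (ρ (stdBasis K i))
  trace_eq_one : opTrace ρ = 1

/-! ### Measurements -/

/-- A normalized positive operator-valued measure on the measurable space `Λ` with values in the
bounded operators on `H` (the values on non-measurable sets are irrelevant). Countable additivity
is in the weak operator topology. -/
structure POVMeasure (Λ H : Type*) [MeasurableSpace Λ] [NormedAddCommGroup H]
    [InnerProductSpace ℂ H] where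
  /-- the operator assigned to an event -/
  op : Set Λ → (H →L[ℂ] H)
  positive : ∀ F, MeasurableSet F → (op F).IsPositive
  op_univ : op univ = ContinuousLinearMap.id ℂ H
  iUnion : ∀ F : ℕ → Set Λ, (∀ i, MeasurableSet (F i)) → Pairwise (Function.onFun Disjoint F) →
    ∀ x y : H, HasSum (fun i => inner ℂ x (op (F i) y)) (inner ℂ x (op (⋃ i, F i) y))

/-! ### Bipartite scenarios -/

section Bipartite

variable {H₁ H₂ : Type*}
  [NormedAddCommGroup H₁] [InnerProductSpace ℂ H₁] [NormedAddCommGroup H₂] [InnerProductSpace ℂ H₂]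

/-- The scenario parameter `γ` of the quantum `S₁ × S₂`-setting scenario given by the state `ρ` and
the measurements `M₁ s₁`, `M₂ s₂`: the infimum (in `[0, ∞]`) of the total variation norms of all
normalized bounded real-valued measures `μ` on `Λ₁ ^ S₁ × Λ₂ ^ S₂` whose marginals are the joint
distributions `F₁ × F₂ ↦ tr[ρ (M₁ s₁ F₁ ⊗ M₂ s₂ F₂)]`. -/
def scenarioParam₂ (ρ : HilbertTensor H₁ H₂ →L[ℂ] HilbertTensor H₁ H₂) {S₁ S₂ : ℕ}
    {Λ₁ Λ₂ : Type} [MeasurableSpace Λ₁] [MeasurableSpace Λ₂]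
    (M₁ : Fin S₁ → POVMeasure Λ₁ H₁) (M₂ : Fin S₂ → POVMeasure Λ₂ H₂) : ℝ≥0∞ :=
  ⨅ (μ : SignedMeasure ((Fin S₁ → Λ₁) × (Fin S₂ → Λ₂)))
    (_ : μ univ = 1 ∧ ∀ (s₁ : Fin S₁) (s₂ : Fin S₂) (F₁ : Set Λ₁) (F₂ : Set Λ₂),
      MeasurableSet F₁ → MeasurableSet F₂ →
      ((μ {l | l.1 s₁ ∈ F₁ ∧ l.2 s₂ ∈ F₂} : ℝ) : ℂ)
        = opTrace (ρ ∘L opTensor ((M₁ s₁).op F₁) ((M₂ s₂).op F₂))),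
    μ.totalVariation univ

/-- The state parameter `Υ` for the outcome set `Λ₁ × Λ₂`. -/
def maxViolationOn₂ (ρ : HilbertTensor H₁ H₂ →L[ℂ] HilbertTensor H₁ H₂) (S₁ S₂ : ℕ)
    (Λ₁ Λ₂ : Type) [MeasurableSpace Λ₁] [MeasurableSpace Λ₂] : ℝ≥0∞ :=
  ⨆ (M₁ : Fin S₁ → POVMeasure Λ₁ H₁) (M₂ : Fin S₂ → POVMeasure Λ₂ H₂), scenarioParam₂ ρ M₁ M₂

/-- The maximal `S₁ × S₂`-setting Bell violation `Υ` of the state `ρ`: the supremum over all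
standard measurable outcome spaces (`Type` suffices, as each is isomorphic to a Borel subset of
the real line). -/
def maxViolation₂ (ρ : HilbertTensor H₁ H₂ →L[ℂ] HilbertTensor H₁ H₂) (S₁ S₂ : ℕ) : ℝ≥0∞ :=
  ⨆ (Λ₁ : Type) (Λ₂ : Type) (_ : MeasurableSpace Λ₁) (_ : MeasurableSpace Λ₂)
    (_ : StandardBorelSpace Λ₁) (_ : StandardBorelSpace Λ₂), maxViolationOn₂ ρ S₁ S₂ Λ₁ Λ₂

end Bipartite

/-! ### Tripartite scenarios -/

section Tripartite

/-- The Hilbert space tensor product of three Hilbert spaces. -/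
abbrev HilbertTensor₃ (H₁ H₂ H₃ : Type*)
    [NormedAddCommGroup H₁] [InnerProductSpace ℂ H₁]
    [NormedAddCommGroup H₂] [InnerProductSpace ℂ H₂]
    [NormedAddCommGroup H₃] [InnerProductSpace ℂ H₃] : Type _ :=
  HilbertTensor (HilbertTensor H₁ H₂) H₃

variable {H₁ H₂ H₃ : Type*}
  [NormedAddCommGroup H₁] [InnerProductSpace ℂ H₁] [NormedAddCommGroup H₂] [InnerProductSpace ℂ H₂]
  [NormedAddCommGroup H₃] [InnerProductSpace ℂ H₃]

/-- The scenario parameter `γ` of a tripartite quantum scenario. -/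
def scenarioParam₃ (ρ : HilbertTensor₃ H₁ H₂ H₃ →L[ℂ] HilbertTensor₃ H₁ H₂ H₃) {S₁ S₂ S₃ : ℕ}
    {Λ₁ Λ₂ Λ₃ : Type} [MeasurableSpace Λ₁] [MeasurableSpace Λ₂] [MeasurableSpace Λ₃]
    (M₁ : Fin S₁ → POVMeasure Λ₁ H₁) (M₂ : Fin S₂ → POVMeasure Λ₂ H₂)
    (M₃ : Fin S₃ → POVMeasure Λ₃ H₃) : ℝ≥0∞ :=
  ⨅ (μ : SignedMeasure ((Fin S₁ → Λ₁) × (Fin S₂ → Λ₂) × (Fin S₃ → Λ₃)))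
    (_ : μ univ = 1 ∧ ∀ (s₁ : Fin S₁) (s₂ : Fin S₂) (s₃ : Fin S₃)
      (F₁ : Set Λ₁) (F₂ : Set Λ₂) (F₃ : Set Λ₃),
      MeasurableSet F₁ → MeasurableSet F₂ → MeasurableSet F₃ →
      ((μ {l | l.1 s₁ ∈ F₁ ∧ l.2.1 s₂ ∈ F₂ ∧ l.2.2 s₃ ∈ F₃} : ℝ) : ℂ)
        = opTrace (ρ ∘L
            opTensor (opTensor ((M₁ s₁).op F₁) ((M₂ s₂).op F₂)) ((M₃ s₃).op F₃))),
    μ.totalVariation univ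

/-- The tripartite state parameter `Υ` for the outcome set `Λ₁ × Λ₂ × Λ₃`. -/
def maxViolationOn₃ (ρ : HilbertTensor₃ H₁ H₂ H₃ →L[ℂ] HilbertTensor₃ H₁ H₂ H₃) (S₁ S₂ S₃ : ℕ)
    (Λ₁ Λ₂ Λ₃ : Type) [MeasurableSpace Λ₁] [MeasurableSpace Λ₂] [MeasurableSpace Λ₃] : ℝ≥0∞ :=
  ⨆ (M₁ : Fin S₁ → POVMeasure Λ₁ H₁) (M₂ : Fin S₂ → POVMeasure Λ₂ H₂)
    (M₃ : Fin S₃ → POVMeasure Λ₃ H₃), scenarioParam₃ ρ M₁ M₂ M₃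

/-- The maximal `S₁ × S₂ × S₃`-setting Bell violation `Υ` of a tripartite state `ρ`. -/
def maxViolation₃ (ρ : HilbertTensor₃ H₁ H₂ H₃ →L[ℂ] HilbertTensor₃ H₁ H₂ H₃)
    (S₁ S₂ S₃ : ℕ) : ℝ≥0∞ :=
  ⨆ (Λ₁ : Type) (Λ₂ : Type) (Λ₃ : Type)
    (_ : MeasurableSpace Λ₁) (_ : MeasurableSpace Λ₂) (_ : MeasurableSpace Λ₃)
    (_ : StandardBorelSpace Λ₁) (_ : StandardBorelSpace Λ₂) (_ : StandardBorelSpace Λ₃),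
    maxViolationOn₃ ρ S₁ S₂ S₃ Λ₁ Λ₂ Λ₃

end Tripartite

/-! ### Numerical bounds -/

/-- The inclusion of `{0, 1, 2, …, ∞}` in the extended reals. -/
def ENat.toExtReal (n : ℕ∞) : EReal := ((n.toENNReal : ℝ≥0∞) : EReal)

/-- The quotient `a b c / max {a, b, c}`, that is, the product of the two smallest numbers among
`a`, `b`, `c` (which makes sense of the quotient for infinite values as well). -/
def prodDivMax (a b c : ℕ∞) : ℕ∞ := min (a * b) (min (a * c) (b * c))

theorem prodDivMax_natCast (a b c : ℕ) (ha : 0 < a) :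
    prodDivMax a b c = ((a * b * c / max a (max b c) : ℕ) : ℕ∞) := by
  have key : a * b * c = min (a * b) (min (a * c) (b * c)) * max a (max b c) := by
    rcases le_total a b with h1 | h1 <;> rcases le_total a c with h2 | h2 <;>
      rcases le_total b c with h3 | h3
    · rw [min_eq_left, max_eq_right h3, max_eq_right h2]
      exact le_min (Nat.mul_le_mul_left a h3) (by rw [mul_comm a b]; exact Nat.mul_le_mul_left b h2)
    · rw [max_eq_left h3, max_eq_right h1, min_eq_left (Nat.mul_le_mul_right c h1),
        min_eq_right (Nat.mul_le_mul_left a h3)]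
      ring
    · have : a = c := le_antisymm (h1.trans h3) h2
      have : b = c := le_antisymm h3 (h2.trans h1)
      subst_vars; simp
    · rw [max_eq_left h3, max_eq_right h1, min_eq_left (Nat.mul_le_mul_right c h1),
        min_eq_right (Nat.mul_le_mul_left a h3)]
      ring
    · rw [min_eq_left, max_eq_right h3, max_eq_right h2]
      exact le_min (Nat.mul_le_mul_left a h3) (by rw [mul_comm a b]; exact Nat.mul_le_mul_left b h2)
    · have : a = b := le_antisymm (h2.trans h3) h1
      have : b = c := le_antisymm (h1.trans h2) h3
      subst_vars; simp
    · rw [max_eq_left (max_le h1 h2), min_eq_right (Nat.mul_le_mul_right c h1), min_eq_right]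
      · ring
      · rw [mul_comm a b]; exact Nat.mul_le_mul_left b h2
    · rw [max_eq_left (max_le h1 h2), min_eq_right (Nat.mul_le_mul_right c h1), min_eq_right]
      · ring
      · rw [mul_comm a b]; exact Nat.mul_le_mul_left b h2
  have hpos : 0 < max a (max b c) := lt_max_of_lt_left ha
  rw [key, Nat.mul_div_cancel _ hpos, prodDivMax]
  rfl

end

/-! To bound `γ` it suffices to exhibit one signed measure `μp - μm` with the right marginals and
small `μp + μm`. The negative part is confined to one party, or to two parties in the tripartite
case. The measurements of that party need not have a joint observable on `Λ ^ S`, but they always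
have a quasi-joint one: a difference `Np - Nm` of positive operator measures whose marginals are the
given measurements, with `Nm univ = k • 1` and hence `Np univ = (k + 1) • 1`.

The other party needs no negativity. For each sign, the bimeasures `(G, F) ↦ tr[ρ (N G ⊗ M s F)]`
have a first marginal independent of `s`, because every `M s` is normalized. Disintegrating over `G`
and drawing the outcomes for different `s` independently gives one positive measure
(`exists_measure_prod_pi`). The total mass is `(k + 1) + k = 2k + 1`.

There are two sources of `k`. With `k = S - 1` (`exists_isQuasiJoint_settings`), each measurement is
put on its own coordinate axis of `Λ ^ S` and the superfluous point masses are subtracted. With `k =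
d - 1` (`exists_isQuasiJoint_dim`), the matrix of `M t F` is polarized: it is then a combination of
scalar distributions `⟪φ, M t F φ⟫`, and for a fixed vector `φ` such distributions have a classical
coupling over all `t`.

For three parties, quasi-joint observables of two of them are multiplied out and the third is
attached by disintegration. Masses multiply, giving `(2a - 1)(2b - 1) = 4ab - 2(a + b) + 1 ≤ 4ab -
3`, with each of `a`, `b` a number of settings or a dimension. -/

/-! ### Bimeasures and their disintegration -/

/-- A real-valued set function whose restriction to measurable sets is a finite measure. -/
structure IsRealMeasure {X : Type*} [MeasurableSpace X] (f : Set X → ℝ) : Prop where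
  nonneg : ∀ G, MeasurableSet G → 0 ≤ f G
  hasSum : ∀ G : ℕ → Set X, (∀ i, MeasurableSet (G i)) → Pairwise (Function.onFun Disjoint G) →
    HasSum (fun i => f (G i)) (f (⋃ i, G i))

namespace IsRealMeasure

variable {X : Type*} [MeasurableSpace X] {f : Set X → ℝ}

theorem empty (hf : IsRealMeasure f) : f ∅ = 0 := by
  have h := hf.hasSum (fun _ => ∅) (fun _ => MeasurableSet.empty) (fun _ _ _ => by
    simp [Function.onFun])
  exact tendsto_nhds_unique tendsto_const_nhds h.summable.tendsto_atTop_zero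

theorem exists_measure (hf : IsRealMeasure f) :
    ∃ μ : Measure X, IsFiniteMeasure μ ∧ ∀ G, MeasurableSet G → μ.real G = f G := by
  let μ : Measure X := Measure.ofMeasurable (fun s (_ : MeasurableSet s) => ENNReal.ofReal (f s))
    (by simp [hf.empty]) (fun G hG hd => by
      have h := hf.hasSum G hG hd
      rw [← h.tsum_eq, ENNReal.ofReal_tsum_of_nonneg (fun i => hf.nonneg _ (hG i)) h.summable])
  have key : ∀ G, MeasurableSet G → μ G = ENNReal.ofReal (f G) :=
    fun G hG => Measure.ofMeasurable_apply G hG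
  refine ⟨μ, ⟨?_⟩, fun G hG => ?_⟩
  · rw [key _ MeasurableSet.univ]
    exact ENNReal.ofReal_lt_top
  · rw [measureReal_def, key G hG, ENNReal.toReal_ofReal (hf.nonneg G hG)]

theorem of_measure (μ : Measure X) [IsFiniteMeasure μ] : IsRealMeasure (fun G => μ.real G) where
  nonneg _ _ := measureReal_nonneg
  hasSum G hG hd := by
    have h : μ (⋃ i, G i) = ∑' i, μ (G i) := measure_iUnion hd hG
    simp only [measureReal_def]
    rw [h, ENNReal.tsum_toReal_eq fun i => measure_ne_top μ _]
    exact ENNReal.hasSum_toReal (h ▸ measure_ne_top μ _)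

theorem comap {Y : Type*} [MeasurableSpace Y] (hf : IsRealMeasure f) {e : X → Y}
    (he : Measurable e) : IsRealMeasure (fun G => f (e ⁻¹' G)) where
  nonneg G hG := hf.nonneg _ (he hG)
  hasSum G hG hd := by
    simp only [preimage_iUnion]
    exact hf.hasSum _ (fun i => he (hG i)) (fun i j hij => (hd hij).preimage e)

end IsRealMeasure

/-- A real-valued function of two sets that is a finite measure in each argument. -/
structure IsBimeasure {X Y : Type*} [MeasurableSpace X] [MeasurableSpace Y]
    (b : Set X → Set Y → ℝ) : Prop where
  left : ∀ F, MeasurableSet F → IsRealMeasure (fun G => b G F)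
  right : ∀ G, MeasurableSet G → IsRealMeasure (b G)

open ProbabilityTheory Filter Topology in
/-- Disintegration of a bimeasure on `X × ℝ`. -/
theorem IsBimeasure.exists_kernel_real {X : Type*} [MeasurableSpace X] {b : Set X → Set ℝ → ℝ}
    (hb : IsBimeasure b) (m : Measure X) [IsFiniteMeasure m]
    (hm : ∀ G, MeasurableSet G → m.real G = b G univ) :
    ∃ κ : Kernel X ℝ, IsMarkovKernel κ ∧ ∀ G F, MeasurableSet G → MeasurableSet F →
      ∫⁻ x in G, κ x F ∂m = ENNReal.ofReal (b G F) := by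
  have hν : ∀ q : ℚ, ∃ μ : Measure X, IsFiniteMeasure μ ∧
      ∀ G, MeasurableSet G → μ.real G = b G (Iic (q : ℝ)) :=
    fun q => (hb.left _ measurableSet_Iic).exists_measure
  choose ν hνfin hν using hν
  have hl : ∀ G : Set X, ∃ μ : Measure ℝ, IsFiniteMeasure μ ∧
      (MeasurableSet G → ∀ F, MeasurableSet F → μ.real F = b G F) := fun G => by
    by_cases hG : MeasurableSet G
    · obtain ⟨μ, h1, h2⟩ := (hb.right G hG).exists_measure
      exact ⟨μ, h1, fun _ => h2⟩
    · exact ⟨0, inferInstance, fun h => absurd h hG⟩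
  choose l hlfin hl using hl
  have hνl : ∀ q G, MeasurableSet G → ν q G = l G (Iic (q : ℝ)) := fun q G hG => by
    rw [← ENNReal.toReal_eq_toReal_iff' (measure_ne_top _ _) (measure_ne_top _ _)]
    exact (hν q G hG).trans (hl G hG _ measurableSet_Iic).symm
  have hml : ∀ G, MeasurableSet G → m G = l G univ := fun G hG => by
    rw [← ENNReal.toReal_eq_toReal_iff' (measure_ne_top _ _) (measure_ne_top _ _)]
    exact (hm G hG).trans (hl G hG _ MeasurableSet.univ).symm
  have hνm : ∀ q, ν q ≤ m := fun q => Measure.le_intro fun G hG _ => by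
    rw [hνl q G hG, hml G hG]
    exact measure_mono (subset_univ _)
  -- `p q x` is the candidate for the conditional probability of `(-∞, q]` given `x`. Each property
  -- of a distribution function on the rationals holds almost everywhere because it can be compared
  -- after integration over every measurable `G`.
  set p : ℚ → X → ℝ≥0∞ := fun q => (ν q).rnDeriv m with hp
  have hpm : ∀ q, Measurable (p q) := fun q => Measure.measurable_rnDeriv _ _
  have hpint : ∀ q G, MeasurableSet G → ∫⁻ x in G, p q x ∂m = l G (Iic (q : ℝ)) :=
    fun q G hG => by
      rw [← hνl q G hG]
      exact Measure.setLIntegral_rnDeriv (Measure.absolutelyContinuous_of_le (hνm q)) G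
  have hmono : ∀ᵐ x ∂m, Monotone fun q => p q x := by
    simp_rw [Monotone, ae_all_iff]
    refine fun q r hqr => ae_le_of_forall_setLIntegral_le_of_sigmaFinite (hpm q) fun G hG _ => ?_
    rw [hpint _ _ hG, hpint _ _ hG]
    exact measure_mono (Iic_subset_Iic.mpr (mod_cast hqr))
  have hle : ∀ᵐ x ∂m, ∀ q, p q x ≤ 1 := by
    rw [ae_all_iff]
    refine fun q => ae_le_of_forall_setLIntegral_le_of_sigmaFinite (hpm q) fun G hG _ => ?_
    rw [hpint _ _ hG]
    simp only [lintegral_one, Measure.restrict_apply, MeasurableSet.univ, univ_inter, hml G hG]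
    exact measure_mono (subset_univ _)
  have hbot : ∀ᵐ x ∂m, ⨅ q, p q x ≤ 0 := by
    refine ae_le_of_forall_setLIntegral_le_of_sigmaFinite (Measurable.iInf hpm) fun G hG _ => ?_
    -- The measure `l G` is placed on `Unit × ℝ` so that limit theorems for measures on a product
    -- with `ℝ` apply to it.
    have h0 := Measure.tendsto_IicSnd_atBot ((Measure.dirac ()).prod (l G))
      (s := univ) MeasurableSet.univ
    simp only [Measure.IicSnd_apply _ _ MeasurableSet.univ, Measure.prod_prod, measure_univ,
      one_mul] at h0
    refine (ge_of_tendsto' h0 fun q => ?_).trans zero_le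
    rw [← hpint q G hG]
    exact lintegral_mono fun x => iInf_le _ q
  have htop : ∀ᵐ x ∂m, 1 ≤ ⨆ q, p q x := by
    refine ae_le_of_forall_setLIntegral_le_of_sigmaFinite measurable_const fun G hG _ => ?_
    have h1 : Tendsto (fun q : ℚ => l G (Iic (q : ℝ))) atTop (𝓝 (l G univ)) :=
      (tendsto_measure_Iic_atTop (l G)).comp (tendsto_ratCast_atTop_iff.mpr tendsto_id)
    simp only [lintegral_one, Measure.restrict_apply, MeasurableSet.univ, univ_inter, hml G hG]
    refine le_of_tendsto' h1 fun q => ?_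
    rw [← hpint q G hG]
    exact lintegral_mono fun x => le_iSup (fun q => p q x) q
  have hright : ∀ᵐ x ∂m, ∀ t : ℚ, ⨅ r : Ioi t, p r x ≤ p t x := by
    rw [ae_all_iff]
    refine fun t => ae_le_of_forall_setLIntegral_le_of_sigmaFinite
      (Measurable.iInf fun r => hpm r) fun G hG _ => ?_
    have h := Measure.iInf_rat_gt_prod_Iic (ρ := (Measure.dirac ()).prod (l G))
      (s := univ) MeasurableSet.univ t
    simp only [Measure.prod_prod, measure_univ, one_mul] at h
    rw [hpint t G hG, ← h]
    refine le_iInf fun r => ?_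
    rw [← hpint _ G hG]
    exact lintegral_mono fun x => iInf_le (fun r : Ioi t => p r x) r
  have hfm : Measurable fun x q => (p q x).toReal :=
    measurable_pi_iff.mpr fun q => (hpm q).ennreal_toReal
  have hae : ∀ᵐ x ∂m, ∀ q : ℚ, ENNReal.ofReal
      (stieltjesOfMeasurableRat (fun x q => (p q x).toReal) hfm x q) = p q x := by
    filter_upwards [hmono, hle, hbot, htop, hright] with x h1 h2 h3 h4 h5 q
    have hfin : ∀ q, p q x ≠ ∞ := fun q => ((h2 q).trans_lt ENNReal.one_lt_top).ne
    have hpt : IsRatStieltjesPoint (fun x q => (p q x).toReal) x := by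
      refine ⟨fun q r hqr => ENNReal.toReal_mono (hfin r) (h1 hqr), ?_, ?_, fun t => ?_⟩
      · have h : Tendsto (fun q => p q x) atTop (𝓝 1) := by
          rw [← le_antisymm (iSup_le h2) h4]
          exact tendsto_atTop_iSup h1
        exact (ENNReal.tendsto_toReal ENNReal.one_ne_top).comp h
      · have h : Tendsto (fun q => p q x) atBot (𝓝 0) := by
          rw [← le_antisymm h3 zero_le]
          exact tendsto_atBot_iInf h1
        exact (ENNReal.tendsto_toReal ENNReal.zero_ne_top).comp h
      · rw [← ENNReal.toReal_iInf fun r => hfin _]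
        congr 1
        exact le_antisymm (h5 t) (le_iInf fun r => h1 r.2.le)
    rw [stieltjesOfMeasurableRat_eq, toRatCDF_of_isRatStieltjesPoint hpt,
      ENNReal.ofReal_toReal (hfin q)]
  -- On the exceptional null set `stieltjesOfMeasurableRat` falls back to a default distribution
  -- function, so `κ` is Markov at every point.
  let κ : Kernel X ℝ := ⟨fun x => (stieltjesOfMeasurableRat _ hfm x).measure,
    measurable_measure_stieltjesOfMeasurableRat hfm⟩
  have hκ : IsMarkovKernel κ := ⟨fun x => instIsProbabilityMeasure_stieltjesOfMeasurableRat hfm x⟩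
  refine ⟨κ, hκ, fun G F hG hF => ?_⟩
  have hκq : ∀ q : ℚ, ∫⁻ x in G, κ x (Iic (q : ℝ)) ∂m = l G (Iic (q : ℝ)) := fun q => by
    rw [← hpint q G hG]
    refine lintegral_congr_ae (ae_restrict_of_ae ?_)
    filter_upwards [hae] with x hx
    rw [← hx q]
    exact measure_stieltjesOfMeasurableRat_Iic hfm x q
  -- Both finite measures agree on rational half-lines, a π-system generating the Borel sets, and
  -- have the same total mass.
  have heq : κ ∘ₘ (m.restrict G) = l G := by
    refine ext_of_generate_finite _ Real.borel_eq_generateFrom_Iic_rat Real.isPiSystem_Iic_rat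
      ?_ ?_
    · intro s hs
      simp only [mem_iUnion, mem_singleton_iff] at hs
      obtain ⟨q, rfl⟩ := hs
      rw [Measure.bind_apply measurableSet_Iic κ.aemeasurable, hκq]
    · rw [Measure.bind_apply MeasurableSet.univ κ.aemeasurable]
      simp [hml G hG]
  rw [← Measure.bind_apply hF κ.aemeasurable, heq, ← hl G hG F hF, ofReal_measureReal]

open ProbabilityTheory in
/-- Disintegration of a bimeasure whose second factor is a standard Borel space. -/
theorem IsBimeasure.exists_kernel {X Y : Type*} [MeasurableSpace X] [MeasurableSpace Y]
    [StandardBorelSpace Y] [Nonempty Y] {b : Set X → Set Y → ℝ}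
    (hb : IsBimeasure b) (m : Measure X) [IsFiniteMeasure m]
    (hm : ∀ G, MeasurableSet G → m.real G = b G univ) :
    ∃ κ : Kernel X Y, IsMarkovKernel κ ∧ ∀ G F, MeasurableSet G → MeasurableSet F →
      ∫⁻ x in G, κ x F ∂m = ENNReal.ofReal (b G F) := by
  have he := measurableEmbedding_embeddingReal Y
  have hb' : IsBimeasure (fun (G : Set X) (A : Set ℝ) => b G (embeddingReal Y ⁻¹' A)) :=
    ⟨fun F hF => hb.left _ (he.measurable hF), fun G hG => (hb.right G hG).comap he.measurable⟩
  obtain ⟨κ, hκ, h⟩ := hb'.exists_kernel_real m (by simpa using hm)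
  have hinv := he.measurable_invFun
  refine ⟨κ.map he.invFun, Kernel.IsMarkovKernel.map κ hinv, fun G F hG hF => ?_⟩
  simp_rw [Kernel.map_apply' κ hinv _ hF]
  rw [h G _ hG (hinv hF), ← preimage_comp, he.leftInverse_invFun.comp_eq_id, preimage_id]

open ProbabilityTheory in
/-- Bimeasures `b s` on `X × Λ` with a common first marginal `m` are marginals of a measure on
`X × Λ ^ S` (the outcomes for different `s` are independent conditionally on `X`). -/
theorem exists_measure_prod_pi {X Λ ι : Type*} [MeasurableSpace X] [MeasurableSpace Λ]
    [StandardBorelSpace Λ] [Nonempty Λ] [Fintype ι] {b : ι → Set X → Set Λ → ℝ}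
    (hb : ∀ s, IsBimeasure (b s)) (m : Measure X) [IsFiniteMeasure m]
    (hm : ∀ s G, MeasurableSet G → m.real G = b s G univ) :
    ∃ μ : Measure (X × (ι → Λ)), IsFiniteMeasure μ ∧
      ∀ s G F, MeasurableSet G → MeasurableSet F →
        μ.real {p | p.1 ∈ G ∧ p.2 s ∈ F} = b s G F := by
  choose κ hκ h using fun s => (hb s).exists_kernel m (hm s)
  have hmeas : Measurable fun x => Measure.pi fun s => κ s x := by
    refine Measurable.measure_of_isPiSystem_of_isProbabilityMeasure generateFrom_pi.symm
      isPiSystem_pi ?_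
    rintro _ ⟨F, hF, rfl⟩
    simp_rw [Measure.pi_pi]
    exact Finset.measurable_prod _ fun s _ => (κ s).measurable_coe (hF s trivial)
  let K : Kernel X (ι → Λ) := ⟨_, hmeas⟩
  have hK : IsMarkovKernel K := ⟨fun x => by
    change IsProbabilityMeasure (Measure.pi fun s => κ s x)
    infer_instance⟩
  refine ⟨m ⊗ₘ K, inferInstance, fun s G F hG hF => ?_⟩
  have hset : {p : X × (ι → Λ) | p.1 ∈ G ∧ p.2 s ∈ F} = G ×ˢ (Function.eval s ⁻¹' F) := rfl
  rw [hset, measureReal_def, Measure.compProd_apply_prod hG (measurable_pi_apply s hF)]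
  have : ∀ x, K x (Function.eval s ⁻¹' F) = κ s x F := fun x =>
    (measurePreserving_eval (fun s => κ s x) s).measure_preimage hF.nullMeasurableSet
  simp_rw [this]
  rw [h s G F hG hF, ENNReal.toReal_ofReal ((hb s).left F hF |>.nonneg G hG)]

open ProbabilityTheory in
/-- A bimeasure on standard Borel spaces extends to a measure. -/
theorem IsBimeasure.exists_measure {X Y : Type*} [MeasurableSpace X] [MeasurableSpace Y]
    [StandardBorelSpace Y] [Nonempty Y] {b : Set X → Set Y → ℝ} (hb : IsBimeasure b) :
    ∃ μ : Measure (X × Y), IsFiniteMeasure μ ∧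
      ∀ G F, MeasurableSet G → MeasurableSet F → μ.real (G ×ˢ F) = b G F := by
  obtain ⟨m, hm, hmb⟩ := (hb.left univ MeasurableSet.univ).exists_measure
  obtain ⟨κ, hκ, h⟩ := hb.exists_kernel m hmb
  refine ⟨m ⊗ₘ κ, inferInstance, fun G F hG hF => ?_⟩
  rw [measureReal_def, Measure.compProd_apply_prod hG hF, h G F hG hF,
    ENNReal.toReal_ofReal (hb.left F hF |>.nonneg G hG)]

/-! ### The trace against a state as a sum of vector functionals -/

section Trace

variable {K : Type*} [NormedAddCommGroup K] [InnerProductSpace ℂ K] [CompleteSpace K]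

theorem ContinuousLinearMap.IsPositive.exists_sqrt {T : K →L[ℂ] K} (hT : T.IsPositive) :
    ∃ R : K →L[ℂ] K, IsSelfAdjoint R ∧ R ∘L R = T := by
  have h := (ContinuousLinearMap.nonneg_iff_isPositive T).mpr hT
  exact ⟨CFC.sqrt T, (CFC.sqrt_nonneg T).isSelfAdjoint, CFC.sqrt_mul_sqrt_self T h⟩

/-- Parseval in each column: the matrix of a Hilbert–Schmidt operator is square summable. This makes
the double series behind `IsState.exists_hasSum` absolutely convergent. -/
theorem HilbertBasis.summable_norm_inner_sq {ι K : Type*} [NormedAddCommGroup K]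
    [InnerProductSpace ℂ K] (e : HilbertBasis ι ℂ K)
    (T : K →L[ℂ] K) (h : Summable fun j => ‖T (e j)‖ ^ 2) :
    Summable fun p : ι × ι => ‖inner ℂ (e p.2) (T (e p.1))‖ ^ 2 := by
  have hs : ∀ j, HasSum (fun i => ‖inner ℂ (e i) (T (e j))‖ ^ 2) (‖T (e j)‖ ^ 2) := fun j => by
    have h := e.hasSum_inner_mul_inner (T (e j)) (T (e j))
    rw [inner_self_eq_norm_sq_to_K] at h
    have h' := Complex.hasSum_re h
    convert h' using 1
    · ext i
      rw [← inner_conj_symm (T (e j)) (e i), ← Complex.normSq_eq_conj_mul_self,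
        Complex.ofReal_re, Complex.normSq_eq_norm_sq]
    · norm_cast
  refine (summable_prod_of_nonneg fun p => by positivity).mpr ⟨fun j => (hs j).summable, ?_⟩
  simpa only [(hs _).tsum_eq] using h

/-- The expectation functional of a state is a sum of vector functionals. -/
theorem IsState.exists_hasSum {ρ : K →L[ℂ] K} (hρ : IsState ρ) :
    ∃ v : (exists_hilbertBasis ℂ K).choose → K, ∀ A : K →L[ℂ] K,
      HasSum (fun j => inner ℂ (v j) (A (v j))) (opTrace (ρ ∘L A)) := by
  obtain ⟨R, hR, hRR⟩ := hρ.positive.exists_sqrt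
  set e := stdBasis K
  have hsymm : ∀ x y, inner ℂ (R x) y = inner ℂ x (R y) := fun x y => by
    rw [← ContinuousLinearMap.adjoint_inner_right, hR.adjoint_eq]
  have hρR : ∀ x, ρ x = R (R x) := fun x => by rw [← hRR]; rfl
  refine ⟨fun j => R (e j), fun A => ?_⟩
  have h1 : Summable fun j => ‖R (e j)‖ ^ 2 := by
    have h := Complex.hasSum_re hρ.summable.hasSum |>.summable
    refine h.congr fun j => ?_
    rw [hρR, ← hsymm, inner_self_eq_norm_sq_to_K]
    norm_cast
  have h2 : Summable fun j => ‖(A.adjoint ∘L R) (e j)‖ ^ 2 := by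
    refine Summable.of_nonneg_of_le (fun _ => by positivity) (fun j => ?_)
      (h1.mul_left (‖A.adjoint‖ ^ 2))
    rw [← mul_pow]
    exact pow_le_pow_left₀ (norm_nonneg _) (A.adjoint.le_opNorm _) 2
  -- With `v j = R (e j)` and `R² = ρ`, summing `a` over `i` gives `⟪v j, A (v j)⟫`, while summing
  -- over `j` gives the diagonal element `⟪e i, ρ A (e i)⟫`. Absolute convergence allows the
  -- exchange.
  let a := fun p : _ × _ => inner ℂ (e p.2) (R (e p.1)) *
    inner ℂ ((A.adjoint ∘L R) (e p.1)) (e p.2)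
  have ha : Summable a := by
    refine Summable.of_norm_bounded ((e.summable_norm_inner_sq R h1).add
      (e.summable_norm_inner_sq _ h2)) fun p => ?_
    rw [norm_mul, ← norm_inner_symm (e p.2)]
    nlinarith [sq_nonneg (‖inner ℂ (e p.2) (R (e p.1))‖ -
      ‖inner ℂ (e p.2) ((A.adjoint ∘L R) (e p.1))‖),
      sq_nonneg (‖inner ℂ (e p.2) (R (e p.1))‖),
      sq_nonneg (‖inner ℂ (e p.2) ((A.adjoint ∘L R) (e p.1))‖)]
  have hj : ∀ j, HasSum (fun i => a (j, i)) (inner ℂ (R (e j)) (A (R (e j)))) := fun j => by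
    have h := e.hasSum_inner_mul_inner ((A.adjoint ∘L R) (e j)) (R (e j))
    rw [ContinuousLinearMap.comp_apply, ContinuousLinearMap.adjoint_inner_left] at h
    exact h.congr_fun fun i => mul_comm _ _
  have hi : ∀ i, HasSum (fun j => a (j, i)) (inner ℂ (e i) ((ρ ∘L A) (e i))) := fun i => by
    have h := e.hasSum_inner_mul_inner (R (e i)) (R (A (e i)))
    rw [hsymm, ← hρR] at h
    refine h.congr_fun fun j => ?_
    simp only [a, ContinuousLinearMap.comp_apply]
    rw [ContinuousLinearMap.adjoint_inner_left, hsymm, hsymm]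
  have htr := HasSum.prod_fiberwise ((Equiv.prodComm _ _).hasSum_iff.mpr ha.hasSum) hi
  rw [opTrace, htr.tsum_eq]
  exact ha.hasSum.prod_fiberwise hj

end Trace

/-! ### Positive operator measures and expectations in a state -/

/-- A positive operator-valued measure on `X`, not necessarily normalized. -/
structure IsOpMeasure {X H : Type*} [MeasurableSpace X] [NormedAddCommGroup H]
    [InnerProductSpace ℂ H] (N : Set X → (H →L[ℂ] H)) : Prop where
  positive : ∀ G, MeasurableSet G → (N G).IsPositive
  hasSum : ∀ G : ℕ → Set X, (∀ i, MeasurableSet (G i)) → Pairwise (Function.onFun Disjoint G) →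
    ∀ x y : H, HasSum (fun i => inner ℂ x (N (G i) y)) (inner ℂ x (N (⋃ i, G i) y))

theorem POVMeasure.isOpMeasure {Λ H : Type*} [MeasurableSpace Λ] [NormedAddCommGroup H]
    [InnerProductSpace ℂ H] (M : POVMeasure Λ H) : IsOpMeasure M.op :=
  ⟨M.positive, M.iUnion⟩

/-- Tonelli for double series. It carries countable additivity of each `⟪v j, N G (v j)⟫` through
the sum over `j` that represents the state. -/
theorem hasSum_of_fiberwise_nonneg {ι : Type*} {f : ℕ → ι → ℝ} (hf : ∀ i j, 0 ≤ f i j)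
    {g : ι → ℝ} {h : ℕ → ℝ} {a : ℝ} (hg : ∀ j, HasSum (fun i => f i j) (g j))
    (hh : ∀ i, HasSum (f i) (h i)) (ha : HasSum g a) : HasSum h a := by
  have hs : Summable fun p : ι × ℕ => f p.2 p.1 :=
    (summable_prod_of_nonneg fun p => hf _ _).mpr ⟨fun j => (hg j).summable, by
      simpa only [(hg _).tsum_eq] using ha.summable⟩
  have h1 := hs.hasSum.prod_fiberwise hg
  rw [ha.unique h1]
  exact HasSum.prod_fiberwise ((Equiv.prodComm _ _).hasSum_iff.mpr hs.hasSum) hh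

/-- The expectation functional of a state. -/
noncomputable def stateExp {K : Type*} [NormedAddCommGroup K] [InnerProductSpace ℂ K]
    [CompleteSpace K] (ρ : K →L[ℂ] K) (A : K →L[ℂ] K) : ℝ :=
  (opTrace (ρ ∘L A)).re

section StateExp

variable {K : Type*} [NormedAddCommGroup K] [InnerProductSpace ℂ K] [CompleteSpace K]
  {ρ : K →L[ℂ] K}

theorem IsState.stateExp_one (hρ : IsState ρ) : stateExp ρ (ContinuousLinearMap.id ℂ K) = 1 := by
  rw [stateExp, ContinuousLinearMap.comp_id, hρ.trace_eq_one, Complex.one_re]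

theorem IsState.stateExp_add (hρ : IsState ρ) (A B : K →L[ℂ] K) :
    stateExp ρ (A + B) = stateExp ρ A + stateExp ρ B := by
  obtain ⟨v, hv⟩ := hρ.exists_hasSum
  rw [stateExp, stateExp, stateExp, ← Complex.add_re]
  congr 1
  refine (hv (A + B)).unique (((hv A).add (hv B)).congr_fun fun j => ?_)
  simp

/-- Each term `⟪v j, A (v j)⟫` is real, so taking real parts loses nothing. The marginal condition
defining `γ` is an equation in `ℂ`. -/
theorem IsState.coe_stateExp (hρ : IsState ρ) {A : K →L[ℂ] K} (hA : A.IsPositive) :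
    (stateExp ρ A : ℂ) = opTrace (ρ ∘L A) := by
  obtain ⟨v, hv⟩ := hρ.exists_hasSum
  have h := (Complex.hasSum_ofReal.mpr (Complex.hasSum_re (hv A)))
  refine (hv A).unique (h.congr_fun fun j => ?_) |>.symm
  have h0 := (Complex.nonneg_iff.mp (hA.inner_nonneg_right (v j))).2
  exact Complex.ext rfl (by simpa using h0.symm)

theorem IsState.stateExp_nonneg (hρ : IsState ρ) {A : K →L[ℂ] K} (hA : A.IsPositive) :
    0 ≤ stateExp ρ A := by
  obtain ⟨v, hv⟩ := hρ.exists_hasSum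
  exact (Complex.hasSum_re (hv A)).nonneg fun j => hA.re_inner_nonneg_right (v j)

theorem IsState.isRealMeasure (hρ : IsState ρ) {X : Type*} [MeasurableSpace X]
    {N : Set X → (K →L[ℂ] K)} (hN : IsOpMeasure N) : IsRealMeasure fun G => stateExp ρ (N G) where
  nonneg G hG := hρ.stateExp_nonneg (hN.positive G hG)
  hasSum G hG hd := by
    obtain ⟨v, hv⟩ := hρ.exists_hasSum
    exact hasSum_of_fiberwise_nonneg
      (fun i j => (hN.positive (G i) (hG i)).re_inner_nonneg_right (v j))
      (fun j => Complex.hasSum_re (hN.hasSum G hG hd (v j) (v j)))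
      (fun i => Complex.hasSum_re (hv (N (G i)))) (Complex.hasSum_re (hv _))

end StateExp

/-! ### Tensor products of operators and of operator measures -/

section OpTensor

variable {H K : Type*} [NormedAddCommGroup H] [InnerProductSpace ℂ H]
  [NormedAddCommGroup K] [InnerProductSpace ℂ K]

/-- Continuous linear maps on the Hilbert tensor product agree if they agree on pure tensors. -/
theorem HilbertTensor.clm_ext {V : Type*} [NormedAddCommGroup V] [NormedSpace ℂ V]
    {f g : HilbertTensor H K →L[ℂ] V}
    (h : ∀ (x : H) (y : K), f ((x ⊗ₜ[ℂ] y : H ⊗[ℂ] K) : HilbertTensor H K)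
      = g ((x ⊗ₜ[ℂ] y : H ⊗[ℂ] K) : HilbertTensor H K)) : f = g := by
  ext ξ
  refine UniformSpace.Completion.induction_on ξ (isClosed_eq f.continuous g.continuous) fun t => ?_
  induction t using TensorProduct.induction_on with
  | zero => simp [UniformSpace.Completion.coe_zero]
  | tmul x y => exact h x y
  | add a b ha hb => rw [UniformSpace.Completion.coe_add, map_add, map_add, ha, hb]

theorem opTensor_add_left (X X' : H →L[ℂ] H) (Y : K →L[ℂ] K) :
    opTensor (X + X') Y = opTensor X Y + opTensor X' Y :=
  HilbertTensor.clm_ext fun x y => by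
    simp [opTensor_tmul, TensorProduct.add_tmul, UniformSpace.Completion.coe_add]

theorem opTensor_add_right (X : H →L[ℂ] H) (Y Y' : K →L[ℂ] K) :
    opTensor X (Y + Y') = opTensor X Y + opTensor X Y' :=
  HilbertTensor.clm_ext fun x y => by
    simp [opTensor_tmul, TensorProduct.tmul_add, UniformSpace.Completion.coe_add]

theorem opTensor_id : opTensor (ContinuousLinearMap.id ℂ H) (ContinuousLinearMap.id ℂ K)
    = ContinuousLinearMap.id ℂ _ :=
  HilbertTensor.clm_ext fun x y => by simp [opTensor_tmul]

theorem opTensor_comp (X X' : H →L[ℂ] H) (Y Y' : K →L[ℂ] K) :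
    opTensor (X ∘L X') (Y ∘L Y') = opTensor X Y ∘L opTensor X' Y' :=
  HilbertTensor.clm_ext fun x y => by simp [opTensor_tmul]

theorem inner_opTensor_comm {X X' : H →L[ℂ] H} {Y Y' : K →L[ℂ] K}
    (hX : ∀ x x', inner ℂ (X x) x' = inner ℂ x (X' x'))
    (hY : ∀ y y', inner ℂ (Y y) y' = inner ℂ y (Y' y')) (ξ ζ : HilbertTensor H K) :
    inner ℂ (opTensor X Y ξ) ζ = inner ℂ ξ (opTensor X' Y' ζ) := by
  refine UniformSpace.Completion.induction_on₂ ξ ζ (isClosed_eq (by fun_prop) (by fun_prop))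
    fun s t => ?_
  induction s using TensorProduct.induction_on with
  | zero => simp [UniformSpace.Completion.coe_zero]
  | add a b ha hb =>
    rw [UniformSpace.Completion.coe_add, map_add, inner_add_left, inner_add_left, ha, hb]
  | tmul x y =>
    induction t using TensorProduct.induction_on with
    | zero => simp [UniformSpace.Completion.coe_zero]
    | add a b ha hb =>
      rw [UniformSpace.Completion.coe_add, map_add, inner_add_right, inner_add_right, ha, hb]
    | tmul x' y' =>
      simp [opTensor_tmul, UniformSpace.Completion.inner_coe, TensorProduct.inner_tmul, hX, hY]

/-- `X ⊗ Y` is the square of the symmetric operator `√X ⊗ √Y`. -/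
theorem opTensor_isPositive [CompleteSpace H] [CompleteSpace K] {X : H →L[ℂ] H} {Y : K →L[ℂ] K}
    (hX : X.IsPositive) (hY : Y.IsPositive) : (opTensor X Y).IsPositive := by
  obtain ⟨A, hA, rfl⟩ := hX.exists_sqrt
  obtain ⟨B, hB, rfl⟩ := hY.exists_sqrt
  have hsymm := inner_opTensor_comm (X := A) (X' := A) (Y := B) (Y' := B)
    (fun x x' => by rw [← ContinuousLinearMap.adjoint_inner_right, hA.adjoint_eq])
    (fun x x' => by rw [← ContinuousLinearMap.adjoint_inner_right, hB.adjoint_eq])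
  rw [ContinuousLinearMap.isPositive_iff_complex]
  intro ξ
  rw [opTensor_comp, ContinuousLinearMap.comp_apply, hsymm, inner_self_eq_norm_sq_to_K]
  norm_cast
  exact ⟨rfl, by positivity⟩

theorem norm_opTensor_le (X : H →L[ℂ] H) (Y : K →L[ℂ] K) : ‖opTensor X Y‖ ≤ ‖X‖ * ‖Y‖ := by
  refine ContinuousLinearMap.opNorm_le_bound _ (by positivity) fun ξ => ?_
  refine UniformSpace.Completion.induction_on ξ (isClosed_le (by fun_prop) (by fun_prop)) fun t => ?_
  rw [opTensor, ContinuousLinearMap.completion_apply_coe, UniformSpace.Completion.norm_coe,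
    UniformSpace.Completion.norm_coe]
  exact ((TensorProduct.mapL X Y).le_opNorm t).trans
    (mul_le_mul_of_nonneg_right (TensorProduct.norm_mapL_le X Y) (norm_nonneg _))

theorem opTensor_sum_left {ι : Type*} (s : Finset ι) (A : ι → H →L[ℂ] H) (Y : K →L[ℂ] K) :
    opTensor (∑ i ∈ s, A i) Y = ∑ i ∈ s, opTensor (A i) Y := by
  classical
  induction s using Finset.induction_on with
  | empty =>
    refine HilbertTensor.clm_ext fun x y => ?_
    simp [opTensor_tmul, UniformSpace.Completion.coe_zero]
  | insert a s ha ih => rw [Finset.sum_insert ha, Finset.sum_insert ha, opTensor_add_left, ih]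

theorem opTensor_sum_right {ι : Type*} (s : Finset ι) (X : H →L[ℂ] H) (A : ι → K →L[ℂ] K) :
    opTensor X (∑ i ∈ s, A i) = ∑ i ∈ s, opTensor X (A i) := by
  classical
  induction s using Finset.induction_on with
  | empty =>
    refine HilbertTensor.clm_ext fun x y => ?_
    simp [opTensor_tmul, UniformSpace.Completion.coe_zero]
  | insert a s ha ih => rw [Finset.sum_insert ha, Finset.sum_insert ha, opTensor_add_right, ih]

end OpTensor

/-- The partial sum lies between `0` and `N (⋃ i, G i)` in the operator order, and the norm is
monotone on positive operators. This is the uniform bound that `HilbertTensor.hasSum_inner` asks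
for. -/
theorem IsOpMeasure.norm_sum_le {X H : Type*} [MeasurableSpace X] [NormedAddCommGroup H]
    [InnerProductSpace ℂ H] [CompleteSpace H] {N : Set X → (H →L[ℂ] H)} (hN : IsOpMeasure N)
    {G : ℕ → Set X} (hG : ∀ i, MeasurableSet (G i)) (hd : Pairwise (Function.onFun Disjoint G))
    (s : Finset ℕ) : ‖∑ i ∈ s, N (G i)‖ ≤ ‖N (⋃ i, G i)‖ := by
  have hpos : (∑ i ∈ s, N (G i)).IsPositive :=
    ContinuousLinearMap.isPositive_sum _ fun i _ => hN.positive _ (hG i)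
  refine CStarAlgebra.norm_le_norm_of_nonneg_of_le
    ((ContinuousLinearMap.nonneg_iff_isPositive _).mpr hpos) ?_
  rw [ContinuousLinearMap.le_def, ContinuousLinearMap.isPositive_def']
  refine ⟨(hN.positive _ (MeasurableSet.iUnion hG)).isSelfAdjoint.sub hpos.isSelfAdjoint,
    fun x => ?_⟩
  rw [ContinuousLinearMap.reApplyInnerSelf_apply, ← inner_re_symm]
  have h := Complex.hasSum_re (hN.hasSum G hG hd x x)
  have hle := sum_le_hasSum s (fun i _ => (hN.positive _ (hG i)).re_inner_nonneg_right x) h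
  simp only [_root_.sub_apply, _root_.sum_apply, inner_sub_right,
    inner_sum, map_sub, map_sum, sub_nonneg]
  exact hle

open Filter Topology in
/-- Bounded nets of sesquilinear forms converge if they converge on a dense subset. -/
theorem HilbertTensor.hasSum_inner {H K : Type*} [NormedAddCommGroup H] [InnerProductSpace ℂ H]
    [NormedAddCommGroup K] [InnerProductSpace ℂ K]
    {T : ℕ → HilbertTensor H K →L[ℂ] HilbertTensor H K}
    {T₀ : HilbertTensor H K →L[ℂ] HilbertTensor H K} {C : ℝ}
    (hC : ∀ s : Finset ℕ, ‖∑ i ∈ s, T i‖ ≤ C)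
    (h : ∀ (x : H) (y : K) (x' : H) (y' : K),
      HasSum (fun i => inner ℂ ((x ⊗ₜ[ℂ] y : H ⊗[ℂ] K) : HilbertTensor H K)
        (T i ((x' ⊗ₜ[ℂ] y' : H ⊗[ℂ] K) : HilbertTensor H K)))
      (inner ℂ ((x ⊗ₜ[ℂ] y : H ⊗[ℂ] K) : HilbertTensor H K)
        (T₀ ((x' ⊗ₜ[ℂ] y' : H ⊗[ℂ] K) : HilbertTensor H K)))) (ξ ζ : HilbertTensor H K) :
    HasSum (fun i => inner ℂ ξ (T i ζ)) (inner ℂ ξ (T₀ ζ)) := by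
  have halg : ∀ s t : H ⊗[ℂ] K, HasSum (fun i => inner ℂ (s : HilbertTensor H K)
      (T i (t : HilbertTensor H K))) (inner ℂ (s : HilbertTensor H K) (T₀ t)) := fun s t => by
    induction s using TensorProduct.induction_on with
    | zero => simp [UniformSpace.Completion.coe_zero, hasSum_zero]
    | add a b ha hb =>
      simp only [UniformSpace.Completion.coe_add, inner_add_left]
      exact ha.add hb
    | tmul x y =>
      induction t using TensorProduct.induction_on with
      | zero => simp [UniformSpace.Completion.coe_zero, hasSum_zero]
      | add a b ha hb =>
        simp only [UniformSpace.Completion.coe_add, map_add, inner_add_right]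
        exact ha.add hb
      | tmul x' y' => exact h x y x' y'
  have hC0 : 0 ≤ C := (norm_nonneg (∑ i ∈ (∅ : Finset ℕ), T i)).trans (hC ∅)
  set D : Finset ℕ → (HilbertTensor H K →L[ℂ] HilbertTensor H K) := fun s => ∑ i ∈ s, T i - T₀
    with hD
  have hDC : ∀ s, ‖D s‖ ≤ C + ‖T₀‖ := fun s =>
    (norm_sub_le (∑ i ∈ s, T i) T₀).trans (add_le_add (hC s) le_rfl)
  have hiff : ∀ ξ ζ : HilbertTensor H K, HasSum (fun i => inner ℂ ξ (T i ζ)) (inner ℂ ξ (T₀ ζ)) ↔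
      Tendsto (fun s => inner ℂ ξ (D s ζ)) atTop (𝓝 0) := fun ξ ζ => by
    rw [HasSum, SummationFilter.unconditional_filter, ← tendsto_sub_nhds_zero_iff]
    simp [hD, inner_sub_right, inner_sum]
  rw [hiff, Metric.tendsto_atTop]
  simp_rw [hiff] at halg
  intro ε hε
  set B := (C + ‖T₀‖ + 1) with hB
  have hBpos : 0 < B := by positivity
  have hdense := UniformSpace.Completion.denseRange_coe (α := H ⊗[ℂ] K)
  -- Each of the three terms of the splitting below gets `ε / 3`. The vector `t` is chosen before
  -- `s`, since the tolerance for `s` depends on `‖t‖`.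
  obtain ⟨t, ht⟩ := Metric.denseRange_iff.mp hdense ζ (ε / 3 / (B * (‖ξ‖ + 1))) (by positivity)
  obtain ⟨s, hs⟩ := Metric.denseRange_iff.mp hdense ξ
    (ε / 3 / (B * (‖(t : HilbertTensor H K)‖ + 1))) (by positivity)
  obtain ⟨n, hn⟩ := Metric.tendsto_atTop.mp (halg s t) (ε / 3) (by positivity)
  refine ⟨n, fun k hk => ?_⟩
  have h0 := hn k hk
  rw [dist_zero_right] at h0 ⊢
  rw [dist_eq_norm, lt_div_iff₀ (by positivity)] at hs ht
  have hb : ∀ a b : HilbertTensor H K, ‖inner ℂ a (D k b)‖ ≤ B * (‖a‖ * ‖b‖) := fun a b => by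
    calc ‖inner ℂ a (D k b)‖ ≤ ‖a‖ * ‖D k b‖ := norm_inner_le_norm _ _
      _ ≤ ‖a‖ * (B * ‖b‖) := by
        gcongr
        refine ((D k).le_opNorm b).trans ?_
        gcongr
        exact (hDC k).trans (by simp [hB])
      _ = _ := by ring
  have hsplit : inner ℂ ξ (D k ζ) = inner ℂ ξ (D k (ζ - t)) +
      (inner ℂ (ξ - s) (D k t) + inner ℂ (s : HilbertTensor H K) (D k t)) := by
    simp [inner_sub_left, inner_sub_right]
  rw [hsplit]
  have e1 := hb ξ (ζ - t)
  have e2 := hb (ξ - s) t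
  have e3 := norm_add_le (inner ℂ ξ (D k (ζ - t)))
    (inner ℂ (ξ - s) (D k t) + inner ℂ (s : HilbertTensor H K) (D k t))
  have e4 := norm_add_le (inner ℂ (ξ - s) (D k t)) (inner ℂ (s : HilbertTensor H K) (D k t))
  have e5 : B * (‖ξ‖ * ‖ζ - t‖) ≤ ‖ζ - t‖ * (B * (‖ξ‖ + 1)) := by
    nlinarith [mul_nonneg hBpos.le (norm_nonneg (ζ - t))]
  have e6 : B * (‖ξ - s‖ * ‖(t : HilbertTensor H K)‖)
      ≤ ‖ξ - s‖ * (B * (‖(t : HilbertTensor H K)‖ + 1)) := by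
    nlinarith [mul_nonneg hBpos.le (norm_nonneg (ξ - s))]
  linarith

section TensorMeasure

variable {X H K : Type*} [MeasurableSpace X] [NormedAddCommGroup H] [InnerProductSpace ℂ H]
  [CompleteSpace H] [NormedAddCommGroup K] [InnerProductSpace ℂ K] [CompleteSpace K]

/-- On pure tensors the matrix elements factor, so additivity is that of `N` times a constant; the
uniform norm bound extends it to the completion. -/
theorem IsOpMeasure.opTensor_left {N : Set X → (H →L[ℂ] H)} (hN : IsOpMeasure N)
    {Y : K →L[ℂ] K} (hY : Y.IsPositive) : IsOpMeasure fun G => opTensor (N G) Y where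
  positive G hG := opTensor_isPositive (hN.positive G hG) hY
  hasSum G hG hd := by
    refine HilbertTensor.hasSum_inner (C := ‖N (⋃ i, G i)‖ * ‖Y‖) (fun s => ?_) fun x y x' y' => ?_
    · rw [← opTensor_sum_left]
      exact (norm_opTensor_le _ _).trans (by gcongr; exact hN.norm_sum_le hG hd s)
    · simp only [opTensor_tmul, UniformSpace.Completion.inner_coe, TensorProduct.inner_tmul]
      exact (hN.hasSum G hG hd x x').mul_right _

theorem IsOpMeasure.opTensor_right {N : Set X → (K →L[ℂ] K)} (hN : IsOpMeasure N)
    {Y : H →L[ℂ] H} (hY : Y.IsPositive) : IsOpMeasure fun G => opTensor Y (N G) where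
  positive G hG := opTensor_isPositive hY (hN.positive G hG)
  hasSum G hG hd := by
    refine HilbertTensor.hasSum_inner (C := ‖Y‖ * ‖N (⋃ i, G i)‖) (fun s => ?_) fun x y x' y' => ?_
    · rw [← opTensor_sum_right]
      exact (norm_opTensor_le _ _).trans (by gcongr; exact hN.norm_sum_le hG hd s)
    · simp only [opTensor_tmul, UniformSpace.Completion.inner_coe, TensorProduct.inner_tmul]
      exact (hN.hasSum G hG hd y y').mul_left _

end TensorMeasure

namespace IsOpMeasure

variable {X H : Type*} [MeasurableSpace X] [NormedAddCommGroup H] [InnerProductSpace ℂ H]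

theorem comap {Y : Type*} [MeasurableSpace Y] {N : Set X → (H →L[ℂ] H)} (hN : IsOpMeasure N)
    {e : X → Y} (he : Measurable e) : IsOpMeasure fun G => N (e ⁻¹' G) where
  positive G hG := hN.positive _ (he hG)
  hasSum G hG hd := by
    simp only [preimage_iUnion]
    exact hN.hasSum _ (fun i => he (hG i)) (fun i j hij => (hd hij).preimage e)

theorem sum {ι : Type*} (s : Finset ι) {N : ι → Set X → (H →L[ℂ] H)}
    (hN : ∀ a, IsOpMeasure (N a)) : IsOpMeasure fun G => ∑ a ∈ s, N a G where
  positive G hG := ContinuousLinearMap.isPositive_sum _ fun a _ => (hN a).positive G hG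
  hasSum G hG hd x y := by
    simp only [_root_.sum_apply, inner_sum]
    exact hasSum_sum fun a _ => (hN a).hasSum G hG hd x y

theorem add {N N' : Set X → (H →L[ℂ] H)} (hN : IsOpMeasure N) (hN' : IsOpMeasure N') :
    IsOpMeasure fun G => N G + N' G where
  positive G hG := (hN.positive G hG).add (hN'.positive G hG)
  hasSum G hG hd x y := by
    simp only [_root_.add_apply, inner_add_right]
    exact (hN.hasSum G hG hd x y).add (hN'.hasSum G hG hd x y)

open ComplexOrder in
theorem of_real_smul {f : Set X → ℝ} (hf : IsRealMeasure f) {A : H →L[ℂ] H} (hA : A.IsPositive) :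
    IsOpMeasure fun G => (f G : ℂ) • A where
  positive G hG := hA.smul_of_nonneg (by exact_mod_cast hf.nonneg G hG)
  hasSum G hG hd x y := by
    simp only [_root_.smul_apply, inner_smul_right]
    exact (Complex.hasSum_ofReal.mpr (hf.hasSum G hG hd)).mul_right _

theorem empty {N : Set X → (H →L[ℂ] H)} (hN : IsOpMeasure N) : N ∅ = 0 := by
  ext y
  refine ext_inner_left ℂ fun x => ?_
  have h := hN.hasSum (fun _ => ∅) (fun _ => MeasurableSet.empty) (fun _ _ _ => by
    simp [Function.onFun]) x y
  have := tendsto_nhds_unique tendsto_const_nhds h.summable.tendsto_atTop_zero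
  simpa using this

end IsOpMeasure

/-! ### Quasi-joint observables -/

/-- A pair of positive operator-valued measures `Np`, `Nm` on `Λ ^ S` whose difference is a joint
observable for the measurements `M s`, with `Nm univ = k • 1`. -/
structure IsQuasiJoint {Λ H : Type*} [MeasurableSpace Λ] [NormedAddCommGroup H]
    [InnerProductSpace ℂ H] {S : ℕ} (M : Fin S → POVMeasure Λ H) (k : ℕ)
    (Np Nm : Set (Fin S → Λ) → (H →L[ℂ] H)) : Prop where
  pos : IsOpMeasure Np
  neg : IsOpMeasure Nm
  marginal : ∀ t F, MeasurableSet F → Np {l | l t ∈ F} = (M t).op F + Nm {l | l t ∈ F}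
  total : Nm univ = k • ContinuousLinearMap.id ℂ H

section QuasiJoint

variable {Λ H : Type*} [MeasurableSpace Λ] [NormedAddCommGroup H] [InnerProductSpace ℂ H]

/-- `Np` places each `M a` on the `a`-th axis through the base point `c`. The marginal at `t` sees
`M t` once and, from the other `S - 1` axes, the point mass at `x₀` times the identity; `Nm` removes
exactly these. -/
theorem exists_isQuasiJoint_settings [Nonempty Λ] {S : ℕ}
    (M : Fin S → POVMeasure Λ H) : ∃ Np Nm, IsQuasiJoint M (S - 1) Np Nm := by
  obtain ⟨x₀⟩ := ‹Nonempty Λ›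
  let c : Fin S → Λ := fun _ => x₀
  refine ⟨fun G => ∑ a, (M a).op (Function.update c a ⁻¹' G),
    fun G => ∑ _a ∈ Finset.range (S - 1),
      (((Measure.dirac c).real G : ℝ) : ℂ) • ContinuousLinearMap.id ℂ H, ?_, ?_, ?_, ?_⟩
  · exact IsOpMeasure.sum _ fun a => (M a).isOpMeasure.comap (measurable_update c)
  · exact IsOpMeasure.sum _ fun _ => IsOpMeasure.of_real_smul (IsRealMeasure.of_measure _)
      ContinuousLinearMap.isPositive_id
  · intro t F hF
    have hF' : MeasurableSet {l : Fin S → Λ | l t ∈ F} := measurable_pi_apply t hF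
    rw [← Finset.add_sum_erase _ _ (Finset.mem_univ t)]
    congr 1
    · simp
    · have h : ∀ a ∈ Finset.univ.erase t, (M a).op (Function.update c a ⁻¹' {l | l t ∈ F})
          = (((Measure.dirac c).real {l | l t ∈ F} : ℝ) : ℂ) • ContinuousLinearMap.id ℂ H :=
        fun a ha => by
          have hta : t ≠ a := (Finset.ne_of_mem_erase ha).symm
          by_cases hx : x₀ ∈ F
          · have : Function.update c a ⁻¹' {l | l t ∈ F} = univ := by
              ext y; simp [Function.update_of_ne hta, c, hx]
            rw [this, (M a).op_univ, measureReal_def, Measure.dirac_apply' _ hF',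
              indicator_of_mem (by exact hx)]
            simp
          · have : Function.update c a ⁻¹' {l | l t ∈ F} = ∅ := by
              ext y; simp [Function.update_of_ne hta, c, hx]
            rw [this, (M a).isOpMeasure.empty, measureReal_def, Measure.dirac_apply' _ hF',
              indicator_of_notMem (by exact hx)]
            simp
      rw [Finset.sum_congr rfl h, Finset.sum_const, Finset.sum_const,
        Finset.card_erase_of_mem (Finset.mem_univ t), Finset.card_univ, Fintype.card_fin,
        Finset.card_range]
  · simp

/-- For a vector `φ`, the distributions `F ↦ ⟪φ, M s F φ⟫` are marginals of one measure. -/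
theorem exists_measure_pi_inner [StandardBorelSpace Λ] [Nonempty Λ] {S : ℕ}
    (M : Fin S → POVMeasure Λ H) (φ : H) :
    ∃ J : Measure (Fin S → Λ), IsFiniteMeasure J ∧ ∀ t F, MeasurableSet F →
      ((J.real {l | l t ∈ F} : ℝ) : ℂ) = inner ℂ φ ((M t).op F φ) := by
  have hM : ∀ t, IsRealMeasure fun F => (inner ℂ φ ((M t).op F φ)).re := fun t =>
    ⟨fun F hF => ((M t).positive F hF).re_inner_nonneg_right φ,
      fun F hF hd => Complex.hasSum_re ((M t).iUnion F hF hd φ φ)⟩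
  -- A one-point first factor reduces `exists_measure_prod_pi` to a coupling of the distributions
  -- alone. They have the common mass `‖φ‖²`, hence the weight of the Dirac measure below.
  have hb : ∀ t, IsBimeasure fun (G : Set Unit) (F : Set Λ) =>
      (Measure.dirac ()).real G * (inner ℂ φ ((M t).op F φ)).re := fun t =>
    ⟨fun F hF => ⟨fun G _ => mul_nonneg measureReal_nonneg ((hM t).nonneg F hF),
      fun G hG hd => ((IsRealMeasure.of_measure _).hasSum G hG hd).mul_right _⟩,
      fun G _ => ⟨fun F hF => mul_nonneg measureReal_nonneg ((hM t).nonneg F hF),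
      fun F hF hd => ((hM t).hasSum F hF hd).mul_left _⟩⟩
  obtain ⟨μ, hμ, h⟩ := exists_measure_prod_pi hb ((‖φ‖₊ ^ 2) • Measure.dirac ()) (fun t G _ => by
    simp only [(M t).op_univ, ContinuousLinearMap.id_apply, inner_self_eq_norm_sq_to_K,
      measureReal_nnreal_smul_apply]
    rw [mul_comm]
    norm_cast)
  refine ⟨μ.map Prod.snd, inferInstance, fun t F hF => ?_⟩
  have h1 := h t univ F MeasurableSet.univ hF
  have hF' : MeasurableSet {l : Fin S → Λ | l t ∈ F} := measurable_pi_apply t hF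
  rw [map_measureReal_apply measurable_snd hF']
  have h2 : Prod.snd ⁻¹' {l : Fin S → Λ | l t ∈ F} = {p : Unit × (Fin S → Λ) | p.1 ∈ univ ∧
      p.2 t ∈ F} := by ext; simp
  rw [h2, h1]
  have h0 := (RCLike.nonneg_iff.mp (((M t).positive F hF).inner_nonneg_right φ)).2
  exact Complex.ext (by simp) (by simpa using h0.symm)

end QuasiJoint

section RankOne

open InnerProductSpace

variable {H : Type*} [NormedAddCommGroup H] [InnerProductSpace ℂ H]

/-- Polarization. The difference of projectors is `2 (i⁻ʲ |u⟩⟨v| + iʲ |v⟩⟨u|)`, and the scalar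
factor contains `iʲ ⟪u, Y v⟫ + i⁻ʲ ⟪v, Y u⟫` plus a term independent of `j`. Summing over fourth
roots of unity keeps only the products of opposite phase. -/
theorem sum_inner_smul_rankOne_sub (Y : H →L[ℂ] H) (u v : H) :
    ∑ j : Fin 4, inner ℂ (u + Complex.I ^ (j : ℕ) • v) (Y (u + Complex.I ^ (j : ℕ) • v)) •
      (rankOne ℂ (u + Complex.I ^ (j : ℕ) • v) (u + Complex.I ^ (j : ℕ) • v)
        - rankOne ℂ (u - Complex.I ^ (j : ℕ) • v) (u - Complex.I ^ (j : ℕ) • v))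
      = (8 : ℂ) • (inner ℂ u (Y v) • rankOne ℂ u v + inner ℂ v (Y u) • rankOne ℂ v u) := by
  simp only [Fin.sum_univ_four, Fin.val_zero, Fin.val_one, Fin.val_two,
    show ((3 : Fin 4) : ℕ) = 3 from rfl, pow_zero, pow_one, Complex.I_sq, Complex.I_pow_three,
    map_add, map_sub, map_smul, map_smulₛₗ, inner_add_left, inner_add_right, inner_smul_left,
    inner_smul_right, _root_.add_apply, _root_.sub_apply, _root_.smul_apply, Complex.conj_I,
    map_neg, map_one]
  match_scalars <;> ring_nf <;> simp only [Complex.I_sq] <;> ring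

theorem sum_rankOne_sub (u v : H) :
    ∑ j : Fin 4, rankOne ℂ (u - Complex.I ^ (j : ℕ) • v) (u - Complex.I ^ (j : ℕ) • v)
      = (4 : ℂ) • (rankOne ℂ u u + rankOne ℂ v v) := by
  simp only [Fin.sum_univ_four, Fin.val_zero, Fin.val_one, Fin.val_two,
    show ((3 : Fin 4) : ℕ) = 3 from rfl, pow_zero, pow_one, Complex.I_sq, Complex.I_pow_three,
    map_sub, map_smul, map_smulₛₗ, _root_.sub_apply, _root_.smul_apply, Complex.conj_I,
    map_neg, map_one]
  match_scalars <;> ring_nf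
  rw [Complex.I_sq]
  ring

theorem sum_offDiag_eq {ι V : Type*} [Fintype ι] [DecidableEq ι] [AddCommGroup V]
    (g : ι → ι → V) : ∑ p ∈ (Finset.univ : Finset ι).offDiag, g p.1 p.2
      = ∑ k, ∑ l, g k l - ∑ k, g k k := by
  rw [eq_sub_iff_add_eq', ← Finset.sum_diag (s := Finset.univ) (f := fun p : ι × ι => g p.1 p.2),
    ← Finset.sum_union (Finset.disjoint_diag_offDiag _), Finset.diag_union_offDiag,
    Finset.sum_product]

theorem OrthonormalBasis.sum_inner_smul_rankOne {ι : Type*} [Fintype ι]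
    (f : OrthonormalBasis ι ℂ H) (Y : H →L[ℂ] H) :
    ∑ k, ∑ l, inner ℂ (f k) (Y (f l)) • rankOne ℂ (f k) (f l) = Y := by
  ext z
  simp only [_root_.sum_apply, _root_.smul_apply, rankOne_apply]
  conv_rhs => rw [← f.sum_repr' z, map_sum]
  rw [Finset.sum_comm]
  refine Finset.sum_congr rfl fun l _ => ?_
  rw [map_smul]
  conv_rhs => rw [← f.sum_repr' (Y (f l)), Finset.smul_sum]
  exact Finset.sum_congr rfl fun k _ => smul_comm _ _ _

/-- The diagonal of `M t F` in the basis `f` is positive already. Each off-diagonal pair is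
polarized into scalars `⟪φ, M t F φ⟫` times differences of positive rank-one operators, and the
scalars are replaced by the coupling `J φ` of all settings. The terms with `φ` go to `Np`, those
with `ψ` to `Nm`. -/
theorem exists_isQuasiJoint_dim {Λ : Type*} [MeasurableSpace Λ] [StandardBorelSpace Λ] [Nonempty Λ]
    {S d : ℕ} (hS : 1 ≤ S) (f : OrthonormalBasis (Fin d) ℂ H) (M : Fin S → POVMeasure Λ H) :
    ∃ Np Nm, IsQuasiJoint M (d - 1) Np Nm := by
  choose J hJfin hJ using exists_measure_pi_inner M
  have hJuniv : ∀ φ, (((J φ).real univ : ℝ) : ℂ) = inner ℂ φ φ := fun φ => by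
    have h := hJ φ ⟨0, hS⟩ univ MeasurableSet.univ
    rw [(M _).op_univ] at h
    simpa using h
  let φ : Fin d × Fin d → Fin 4 → H := fun p j => f p.1 + Complex.I ^ (j : ℕ) • f p.2
  let ψ : Fin d × Fin d → Fin 4 → H := fun p j => f p.1 - Complex.I ^ (j : ℕ) • f p.2
  -- The factor `1/16` is half of `1/8`, the inverse of the polarization constant, because `offDiag`
  -- lists each pair in both orders.
  let P : (Fin d × Fin d → Fin 4 → H) → Set (Fin S → Λ) → (H →L[ℂ] H) := fun χ G =>
    ∑ p ∈ Finset.univ.offDiag, ∑ j, (((J (φ p j)).real G : ℝ) : ℂ) •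
      ((16 : ℂ)⁻¹ • rankOne ℂ (χ p j) (χ p j))
  have hP : ∀ χ, IsOpMeasure (P χ) := fun χ => IsOpMeasure.sum _ fun p => IsOpMeasure.sum _ fun j =>
    IsOpMeasure.of_real_smul (IsRealMeasure.of_measure _)
      ((isPositive_rankOne_self _).smul_of_nonneg (by
        rw [Complex.nonneg_iff]; norm_num))
  refine ⟨fun G => ∑ k, (((J (f k)).real G : ℝ) : ℂ) • rankOne ℂ (f k) (f k) + P φ G, P ψ,
    (IsOpMeasure.sum _ fun k => IsOpMeasure.of_real_smul (IsRealMeasure.of_measure _)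
      (isPositive_rankOne_self _)).add (hP φ), hP ψ, fun t F hF => ?_, ?_⟩
  · simp only [P, hJ _ t F hF]
    rw [← sub_eq_iff_eq_add, add_sub_assoc, ← Finset.sum_sub_distrib]
    have h : ∀ p : Fin d × Fin d,
        ∑ j, inner ℂ (φ p j) ((M t).op F (φ p j)) • ((16 : ℂ)⁻¹ • rankOne ℂ (φ p j) (φ p j))
        - ∑ j, inner ℂ (φ p j) ((M t).op F (φ p j)) • ((16 : ℂ)⁻¹ • rankOne ℂ (ψ p j) (ψ p j))
        = (2 : ℂ)⁻¹ • (inner ℂ (f p.1) ((M t).op F (f p.2)) • rankOne ℂ (f p.1) (f p.2)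
          + inner ℂ (f p.2) ((M t).op F (f p.1)) • rankOne ℂ (f p.2) (f p.1)) := fun p => by
      have h8 := congrArg ((16 : ℂ)⁻¹ • ·)
        (sum_inner_smul_rankOne_sub ((M t).op F) (f p.1) (f p.2))
      simp only [smul_smul] at h8
      rw [show (16 : ℂ)⁻¹ * 8 = 2⁻¹ by norm_num] at h8
      rw [← h8, ← Finset.sum_sub_distrib, Finset.smul_sum]
      refine Finset.sum_congr rfl fun j _ => ?_
      rw [← smul_sub, ← smul_sub, smul_comm]
    rw [Finset.sum_congr rfl fun p _ => h p, sum_offDiag_eq (fun k l =>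
      (2 : ℂ)⁻¹ • (inner ℂ (f k) ((M t).op F (f l)) • rankOne ℂ (f k) (f l)
          + inner ℂ (f l) ((M t).op F (f k)) • rankOne ℂ (f l) (f k)))]
    simp only [← Finset.smul_sum, Finset.sum_add_distrib]
    rw [Finset.sum_comm (f := fun k l => inner ℂ (f l) ((M t).op F (f k)) • rankOne ℂ (f l) (f k)),
      f.sum_inner_smul_rankOne]
    module
  -- Since `⟪φ, φ⟫ = 2`, each ordered pair contributes `2 · 4 / 16 = 1/2` of the two basis
  -- projectors. A basis vector lies in `2 (d - 1)` ordered pairs, which gives `(d - 1) • 1`.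
  · have h : ∀ p ∈ (Finset.univ : Finset (Fin d)).offDiag,
        ∑ j, (((J (φ p j)).real univ : ℝ) : ℂ) • ((16 : ℂ)⁻¹ • rankOne ℂ (ψ p j) (ψ p j))
        = (2 : ℂ)⁻¹ • (rankOne ℂ (f p.1) (f p.1) + rankOne ℂ (f p.2) (f p.2)) := fun p hp => by
      have hne : p.1 ≠ p.2 := (Finset.mem_offDiag.mp hp).2.2
      have h2 : ∀ j, inner ℂ (φ p j) (φ p j) = 2 := fun j => by
        have hI : (starRingEnd ℂ) (Complex.I ^ (j : ℕ)) * Complex.I ^ (j : ℕ) = 1 := by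
          rw [map_pow, ← mul_pow]
          simp
        simp only [φ, inner_add_left, inner_add_right, inner_smul_left, inner_smul_right,
          f.inner_eq_one, f.inner_eq_zero hne, f.inner_eq_zero hne.symm]
        linear_combination hI
      simp only [hJuniv, h2]
      rw [← Finset.smul_sum, ← Finset.smul_sum, sum_rankOne_sub]
      module
    rw [show P ψ univ = _ from Finset.sum_congr rfl h, sum_offDiag_eq (fun k l =>
      (2 : ℂ)⁻¹ • (rankOne ℂ (f k) (f k) + rankOne ℂ (f l) (f l)))]
    have hid := f.sum_inner_smul_rankOne (ContinuousLinearMap.id ℂ H)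
    have hid' : ∑ k, rankOne ℂ (f k) (f k) = ContinuousLinearMap.id ℂ H := by
      rw [← hid]
      refine Finset.sum_congr rfl fun k _ => ?_
      rw [Finset.sum_eq_single k (fun l _ hl => by simp [f.inner_eq_zero hl.symm]) (by simp)]
      simp
    simp only [← Finset.smul_sum, Finset.sum_add_distrib, hid', Finset.sum_const, Finset.card_univ,
      Fintype.card_fin]
    -- For `d = 0` the truncated `d - 1` is `0`, and the identity itself vanishes.
    rcases d with _ | d
    · simp only [Finset.univ_eq_empty, Finset.sum_empty] at hid'
      simp [← hid']
    · simp only [Nat.add_sub_cancel, ← Nat.cast_smul_eq_nsmul ℂ]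
      push_cast
      module

/-- A quasi-joint observable with negative part `a - 1`, for `a` the number of settings or the
dimension of the Hilbert space. -/
theorem exists_isQuasiJoint {Λ : Type*} [MeasurableSpace Λ] [StandardBorelSpace Λ] [Nonempty Λ]
    {S a : ℕ} (hS : 1 ≤ S) (M : Fin S → POVMeasure Λ H) (ha : a = S ∨ hilbertDim H = a) :
    ∃ Np Nm, IsQuasiJoint M (a - 1) Np Nm := by
  rcases ha with rfl | ha
  · exact exists_isQuasiJoint_settings M
  · have hrank : Module.rank ℂ H = a := Cardinal.toENat_eq_natCast.mp ha
    have : FiniteDimensional ℂ H := Module.finite_of_rank_eq_nat hrank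
    have hfr : Module.finrank ℂ H = a := Module.finrank_eq_of_rank_eq hrank
    exact exists_isQuasiJoint_dim hS ((stdOrthonormalBasis ℂ H).reindex (finCongr hfr)) M

end RankOne

theorem totalVariation_sub_le {X : Type*} [MeasurableSpace X] (μ ν : Measure X)
    [IsFiniteMeasure μ] [IsFiniteMeasure ν] :
    (μ.toSignedMeasure - ν.toSignedMeasure).totalVariation univ
      ≤ ENNReal.ofReal (μ.real univ + ν.real univ) := by
  rw [SignedMeasure.totalVariation_eq_variation,
    ENNReal.ofReal_add measureReal_nonneg measureReal_nonneg, ofReal_measureReal,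
    ofReal_measureReal]
  refine (VectorMeasure.variation_sub_le univ).trans ?_
  simp

theorem apply_nsmul_of_additive {H : Type*} [NormedAddCommGroup H] [InnerProductSpace ℂ H]
    {e : (H →L[ℂ] H) → ℝ} (hadd : ∀ A B, e (A + B) = e A + e B) (n : ℕ) (A : H →L[ℂ] H) :
    e (n • A) = n * e A := by
  induction n with
  | zero =>
    have := hadd 0 0
    simp only [add_zero] at this
    simp only [zero_smul, Nat.cast_zero, zero_mul]
    linarith
  | succ n ih =>
    rw [succ_nsmul, hadd, ih]
    push_cast
    ring

/-- On an empty outcome space the identity would equal the value at `∅`, which is `0`. Standard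
Borel spaces may be empty, whereas the couplings need a point. -/
theorem POVMeasure.nonempty {Λ H : Type*} [MeasurableSpace Λ] [NormedAddCommGroup H]
    [InnerProductSpace ℂ H] [Nontrivial H] (M : POVMeasure Λ H) : Nonempty Λ := by
  by_contra h
  have : IsEmpty Λ := not_nonempty_iff.mp h
  have h1 := M.op_univ
  rw [univ_eq_empty_iff.mpr this, M.isOpMeasure.empty] at h1
  obtain ⟨x, hx⟩ := exists_ne (0 : H)
  exact hx (congrArg (fun T => T x) h1).symm

/-! ### Quasi-classical models for two parties -/

section Bipartite

variable {H₁ H₂ : Type*} [NormedAddCommGroup H₁] [InnerProductSpace ℂ H₁]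
  [NormedAddCommGroup H₂] [InnerProductSpace ℂ H₂]

/-- Expectation functionals on product operators: biadditive, normalized, positive and normal. -/
structure IsNormalFunctional₂ (E : (H₁ →L[ℂ] H₁) → (H₂ →L[ℂ] H₂) → ℝ) : Prop where
  add₁ : ∀ A A' B, E (A + A') B = E A B + E A' B
  add₂ : ∀ A B B', E A (B + B') = E A B + E A B'
  one : E (ContinuousLinearMap.id ℂ H₁) (ContinuousLinearMap.id ℂ H₂) = 1
  measure₁ : ∀ {X : Type} [MeasurableSpace X] {N : Set X → (H₁ →L[ℂ] H₁)} {B : H₂ →L[ℂ] H₂},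
    IsOpMeasure N → B.IsPositive → IsRealMeasure fun G => E (N G) B
  measure₂ : ∀ {X : Type} [MeasurableSpace X] {N : Set X → (H₂ →L[ℂ] H₂)} {A : H₁ →L[ℂ] H₁},
    A.IsPositive → IsOpMeasure N → IsRealMeasure fun G => E A (N G)

/-- The joint distributions `b s₁ s₂` are marginals of a normalized signed measure, given as a
difference of two positive measures of total mass `K`. -/
def HasQuasiModel₂ {S₁ S₂ : ℕ} {Λ₁ Λ₂ : Type} [MeasurableSpace Λ₁] [MeasurableSpace Λ₂]
    (b : Fin S₁ → Fin S₂ → Set Λ₁ → Set Λ₂ → ℝ) (K : ℝ) : Prop :=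
  ∃ μp μm : Measure ((Fin S₁ → Λ₁) × (Fin S₂ → Λ₂)), IsFiniteMeasure μp ∧ IsFiniteMeasure μm ∧
    (∀ s₁ s₂ F₁ F₂, MeasurableSet F₁ → MeasurableSet F₂ →
      μp.real {l | l.1 s₁ ∈ F₁ ∧ l.2 s₂ ∈ F₂}
        = b s₁ s₂ F₁ F₂ + μm.real {l | l.1 s₁ ∈ F₁ ∧ l.2 s₂ ∈ F₂}) ∧
    μp.real univ = 1 + μm.real univ ∧ μp.real univ + μm.real univ = K

theorem measurableSet_coords₂ {S₁ S₂ : ℕ} {Λ₁ Λ₂ : Type} [MeasurableSpace Λ₁] [MeasurableSpace Λ₂]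
    {F₁ : Set Λ₁} {F₂ : Set Λ₂} (h₁ : MeasurableSet F₁) (h₂ : MeasurableSet F₂)
    (s₁ : Fin S₁) (s₂ : Fin S₂) :
    MeasurableSet {l : (Fin S₁ → Λ₁) × (Fin S₂ → Λ₂) | l.1 s₁ ∈ F₁ ∧ l.2 s₂ ∈ F₂} :=
  (measurable_pi_apply s₁ h₁).prod (measurable_pi_apply s₂ h₂)

theorem HasQuasiModel₂.swap {S₁ S₂ : ℕ} {Λ₁ Λ₂ : Type} [MeasurableSpace Λ₁] [MeasurableSpace Λ₂]
    {b : Fin S₁ → Fin S₂ → Set Λ₁ → Set Λ₂ → ℝ} {K : ℝ}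
    (h : HasQuasiModel₂ (fun s₂ s₁ F₂ F₁ => b s₁ s₂ F₁ F₂) K) : HasQuasiModel₂ b K := by
  obtain ⟨μp, μm, hp, hm, h1, h2, h3⟩ := h
  have key : ∀ (μ : Measure ((Fin S₂ → Λ₂) × (Fin S₁ → Λ₁))) s₁ s₂ F₁ F₂, MeasurableSet F₁ →
      MeasurableSet F₂ → (μ.map Prod.swap).real {l | l.1 s₁ ∈ F₁ ∧ l.2 s₂ ∈ F₂}
        = μ.real {l | l.1 s₂ ∈ F₂ ∧ l.2 s₁ ∈ F₁} := fun μ s₁ s₂ F₁ F₂ hF₁ hF₂ => by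
    rw [map_measureReal_apply measurable_swap (measurableSet_coords₂ hF₁ hF₂ s₁ s₂)]
    congr 1
    ext l
    exact and_comm
  have huniv : ∀ (μ : Measure ((Fin S₂ → Λ₂) × (Fin S₁ → Λ₁))),
      (μ.map Prod.swap).real univ = μ.real univ := fun μ => by
    rw [map_measureReal_apply measurable_swap MeasurableSet.univ, preimage_univ]
  refine ⟨μp.map Prod.swap, μm.map Prod.swap, inferInstance, inferInstance,
    fun s₁ s₂ F₁ F₂ hF₁ hF₂ => ?_, by rwa [huniv, huniv], by rwa [huniv, huniv]⟩
  rw [key _ _ _ _ _ hF₁ hF₂, key _ _ _ _ _ hF₁ hF₂, h1 s₂ s₁ F₂ F₁ hF₂ hF₁]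

namespace IsNormalFunctional₂

variable {E : (H₁ →L[ℂ] H₁) → (H₂ →L[ℂ] H₂) → ℝ}

/-- The parties are exchanged in the functional rather than in the Hilbert space, so no flip of the
tensor factors is needed. -/
theorem swap (hE : IsNormalFunctional₂ E) : IsNormalFunctional₂ fun B A => E A B where
  add₁ B B' A := hE.add₂ A B B'
  add₂ B A A' := hE.add₁ A A' B
  one := hE.one
  measure₁ hN hB := hE.measure₂ hB hN
  measure₂ hA hN := hE.measure₁ hN hA

theorem nontrivial_left (hE : IsNormalFunctional₂ E) : Nontrivial H₁ := by
  by_contra h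
  have : Subsingleton H₁ := not_nontrivial_iff_subsingleton.mp h
  have h0 := hE.add₁ 0 0 (ContinuousLinearMap.id ℂ H₂)
  have h1 := hE.one
  rw [Subsingleton.elim (ContinuousLinearMap.id ℂ H₁) 0] at h1
  rw [add_zero, h1] at h0
  norm_num at h0

variable {S₁ S₂ : ℕ} {Λ₁ Λ₂ : Type} [MeasurableSpace Λ₁] [MeasurableSpace Λ₂]

/-- No-signalling: since `M s univ` is the identity, all settings `s` induce the same first marginal
`E (N G) 1`, which is what gluing them over `X` requires. -/
theorem exists_measure (hE : IsNormalFunctional₂ E) [StandardBorelSpace Λ₂] [Nonempty Λ₂]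
    {X : Type} [MeasurableSpace X] {N : Set X → (H₁ →L[ℂ] H₁)} (hN : IsOpMeasure N)
    (M : Fin S₂ → POVMeasure Λ₂ H₂) :
    ∃ μ : Measure (X × (Fin S₂ → Λ₂)), IsFiniteMeasure μ ∧
      ∀ s G F, MeasurableSet G → MeasurableSet F →
        μ.real {p | p.1 ∈ G ∧ p.2 s ∈ F} = E (N G) ((M s).op F) := by
  obtain ⟨m, hm, hmN⟩ :=
    (hE.measure₁ hN (ContinuousLinearMap.isPositive_id (E := H₂))).exists_measure
  exact exists_measure_prod_pi (fun s => ⟨fun F hF => hE.measure₁ hN ((M s).positive F hF),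
    fun G hG => hE.measure₂ (hN.positive G hG) (M s).isOpMeasure⟩) m
    (fun s G hG => by rw [hmN G hG, (M s).op_univ])

/-- `Np` and `Nm` are extended separately to positive measures, of masses `k + 1` and `k`. -/
theorem hasQuasiModel (hE : IsNormalFunctional₂ E) [StandardBorelSpace Λ₂] [Nonempty Λ₂]
    (hS₁ : 1 ≤ S₁) (hS₂ : 1 ≤ S₂) (M₁ : Fin S₁ → POVMeasure Λ₁ H₁)
    (M₂ : Fin S₂ → POVMeasure Λ₂ H₂) {k : ℕ} {Np Nm} (hN : IsQuasiJoint M₁ k Np Nm) :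
    HasQuasiModel₂ (fun s₁ s₂ F₁ F₂ => E ((M₁ s₁).op F₁) ((M₂ s₂).op F₂)) (2 * k + 1) := by
  obtain ⟨μp, hμp, hp⟩ := hE.exists_measure hN.pos M₂
  obtain ⟨μm, hμm, hm⟩ := hE.exists_measure hN.neg M₂
  have huniv : ∀ {N : Set (Fin S₁ → Λ₁) → (H₁ →L[ℂ] H₁)}
      {μ : Measure ((Fin S₁ → Λ₁) × (Fin S₂ → Λ₂))},
      (∀ s G F, MeasurableSet G → MeasurableSet F →
        μ.real {p | p.1 ∈ G ∧ p.2 s ∈ F} = E (N G) ((M₂ s).op F)) →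
      μ.real univ = E (N univ) (ContinuousLinearMap.id ℂ H₂) := fun {N μ} h => by
    have h := h ⟨0, hS₂⟩ univ univ MeasurableSet.univ MeasurableSet.univ
    rw [(M₂ _).op_univ] at h
    simpa using h
  have hk : E (Nm univ) (ContinuousLinearMap.id ℂ H₂) = k := by
    rw [hN.total, apply_nsmul_of_additive (e := fun A => E A _)
      (fun A B => hE.add₁ A B _), hE.one, mul_one]
  have hk' : E (Np univ) (ContinuousLinearMap.id ℂ H₂) = 1 + k := by
    have h := hN.marginal ⟨0, hS₁⟩ univ MeasurableSet.univ
    simp only [mem_univ, ofPred_true, (M₁ _).op_univ] at h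
    rw [h, hE.add₁, hE.one, hk]
  refine ⟨μp, μm, hμp, hμm, fun s₁ s₂ F₁ F₂ hF₁ hF₂ => ?_, ?_, ?_⟩
  · have hG : MeasurableSet {l : Fin S₁ → Λ₁ | l s₁ ∈ F₁} := measurable_pi_apply s₁ hF₁
    have h1 := hp s₂ _ F₂ hG hF₂
    have h2 := hm s₂ _ F₂ hG hF₂
    rw [hN.marginal s₁ F₁ hF₁, hE.add₁] at h1
    simp only [mem_ofPred_eq] at h1 h2
    rw [h1, h2]
  · rw [huniv hp, huniv hm, hk, hk']
  · rw [huniv hp, huniv hm, hk, hk']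
    ring

end IsNormalFunctional₂

end Bipartite

/-! ### Quasi-classical models for three parties -/

section Tripartite

variable {H₁ H₂ H₃ : Type*} [NormedAddCommGroup H₁] [InnerProductSpace ℂ H₁]
  [NormedAddCommGroup H₂] [InnerProductSpace ℂ H₂] [NormedAddCommGroup H₃] [InnerProductSpace ℂ H₃]

/-- Expectation functionals on product operators: triadditive, normalized, positive and normal. -/
structure IsNormalFunctional₃ (E : (H₁ →L[ℂ] H₁) → (H₂ →L[ℂ] H₂) → (H₃ →L[ℂ] H₃) → ℝ) :
    Prop where
  add₁ : ∀ A A' B C, E (A + A') B C = E A B C + E A' B C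
  add₂ : ∀ A B B' C, E A (B + B') C = E A B C + E A B' C
  add₃ : ∀ A B C C', E A B (C + C') = E A B C + E A B C'
  one : E (ContinuousLinearMap.id ℂ H₁) (ContinuousLinearMap.id ℂ H₂)
    (ContinuousLinearMap.id ℂ H₃) = 1
  measure₁ : ∀ {X : Type} [MeasurableSpace X] {N : Set X → (H₁ →L[ℂ] H₁)} {B : H₂ →L[ℂ] H₂}
    {C : H₃ →L[ℂ] H₃}, IsOpMeasure N → B.IsPositive → C.IsPositive →
    IsRealMeasure fun G => E (N G) B C
  measure₂ : ∀ {X : Type} [MeasurableSpace X] {N : Set X → (H₂ →L[ℂ] H₂)} {A : H₁ →L[ℂ] H₁}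
    {C : H₃ →L[ℂ] H₃}, A.IsPositive → IsOpMeasure N → C.IsPositive →
    IsRealMeasure fun G => E A (N G) C
  measure₃ : ∀ {X : Type} [MeasurableSpace X] {N : Set X → (H₃ →L[ℂ] H₃)} {A : H₁ →L[ℂ] H₁}
    {B : H₂ →L[ℂ] H₂}, A.IsPositive → B.IsPositive → IsOpMeasure N →
    IsRealMeasure fun G => E A B (N G)

/-- The joint distributions `b s₁ s₂ s₃` are marginals of a normalized signed measure, given as a
difference of two positive measures of total mass `K`. -/
def HasQuasiModel₃ {S₁ S₂ S₃ : ℕ} {Λ₁ Λ₂ Λ₃ : Type} [MeasurableSpace Λ₁] [MeasurableSpace Λ₂]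
    [MeasurableSpace Λ₃]
    (b : Fin S₁ → Fin S₂ → Fin S₃ → Set Λ₁ → Set Λ₂ → Set Λ₃ → ℝ) (K : ℝ) : Prop :=
  ∃ μp μm : Measure ((Fin S₁ → Λ₁) × (Fin S₂ → Λ₂) × (Fin S₃ → Λ₃)),
    IsFiniteMeasure μp ∧ IsFiniteMeasure μm ∧
    (∀ s₁ s₂ s₃ F₁ F₂ F₃, MeasurableSet F₁ → MeasurableSet F₂ → MeasurableSet F₃ →
      μp.real {l | l.1 s₁ ∈ F₁ ∧ l.2.1 s₂ ∈ F₂ ∧ l.2.2 s₃ ∈ F₃}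
        = b s₁ s₂ s₃ F₁ F₂ F₃ + μm.real {l | l.1 s₁ ∈ F₁ ∧ l.2.1 s₂ ∈ F₂ ∧ l.2.2 s₃ ∈ F₃}) ∧
    μp.real univ = 1 + μm.real univ ∧ μp.real univ + μm.real univ = K

section Coordinates

variable {S₁ S₂ S₃ : ℕ} {Λ₁ Λ₂ Λ₃ : Type} [MeasurableSpace Λ₁] [MeasurableSpace Λ₂]
  [MeasurableSpace Λ₃]

theorem measurableSet_coords₃ {F₁ : Set Λ₁} {F₂ : Set Λ₂} {F₃ : Set Λ₃} (h₁ : MeasurableSet F₁)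
    (h₂ : MeasurableSet F₂) (h₃ : MeasurableSet F₃) (s₁ : Fin S₁) (s₂ : Fin S₂) (s₃ : Fin S₃) :
    MeasurableSet {l : (Fin S₁ → Λ₁) × (Fin S₂ → Λ₂) × (Fin S₃ → Λ₃) |
      l.1 s₁ ∈ F₁ ∧ l.2.1 s₂ ∈ F₂ ∧ l.2.2 s₃ ∈ F₃} :=
  (measurable_pi_apply s₁ h₁).prod
    ((measurable_pi_apply s₂ h₂).prod (measurable_pi_apply s₃ h₃))

theorem HasQuasiModel₃.swap {b : Fin S₁ → Fin S₂ → Fin S₃ → Set Λ₁ → Set Λ₂ → Set Λ₃ → ℝ} {K : ℝ}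
    (h : HasQuasiModel₃ (fun s₁ s₃ s₂ F₁ F₃ F₂ => b s₁ s₂ s₃ F₁ F₂ F₃) K) :
    HasQuasiModel₃ b K := by
  obtain ⟨μp, μm, hp, hm, h1, h2, h3⟩ := h
  let e : (Fin S₁ → Λ₁) × (Fin S₃ → Λ₃) × (Fin S₂ → Λ₂) →
    (Fin S₁ → Λ₁) × (Fin S₂ → Λ₂) × (Fin S₃ → Λ₃) := fun l => (l.1, l.2.2, l.2.1)
  have he : Measurable e := by fun_prop
  have huniv : ∀ μ, (Measure.map e μ).real univ = μ.real univ := fun μ => by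
    rw [map_measureReal_apply he MeasurableSet.univ, preimage_univ]
  refine ⟨μp.map e, μm.map e, inferInstance, inferInstance,
    fun s₁ s₂ s₃ F₁ F₂ F₃ hF₁ hF₂ hF₃ => ?_, by rwa [huniv, huniv], by rwa [huniv, huniv]⟩
  have hpre : e ⁻¹' {l | l.1 s₁ ∈ F₁ ∧ l.2.1 s₂ ∈ F₂ ∧ l.2.2 s₃ ∈ F₃}
      = {l | l.1 s₁ ∈ F₁ ∧ l.2.1 s₃ ∈ F₃ ∧ l.2.2 s₂ ∈ F₂} := by
    ext l
    exact and_congr_right fun _ => and_comm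
  have hmeas := measurableSet_coords₃ hF₁ hF₂ hF₃ s₁ s₂ s₃
  rw [map_measureReal_apply he hmeas, map_measureReal_apply he hmeas, hpre,
    h1 s₁ s₃ s₂ F₁ F₃ F₂ hF₁ hF₃ hF₂]

theorem HasQuasiModel₃.rotate {b : Fin S₁ → Fin S₂ → Fin S₃ → Set Λ₁ → Set Λ₂ → Set Λ₃ → ℝ}
    {K : ℝ} (h : HasQuasiModel₃ (fun s₂ s₃ s₁ F₂ F₃ F₁ => b s₁ s₂ s₃ F₁ F₂ F₃) K) :
    HasQuasiModel₃ b K := by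
  obtain ⟨μp, μm, hp, hm, h1, h2, h3⟩ := h
  let e : (Fin S₂ → Λ₂) × (Fin S₃ → Λ₃) × (Fin S₁ → Λ₁) →
    (Fin S₁ → Λ₁) × (Fin S₂ → Λ₂) × (Fin S₃ → Λ₃) := fun l => (l.2.2, l.1, l.2.1)
  have he : Measurable e := by fun_prop
  have huniv : ∀ μ, (Measure.map e μ).real univ = μ.real univ := fun μ => by
    rw [map_measureReal_apply he MeasurableSet.univ, preimage_univ]
  refine ⟨μp.map e, μm.map e, inferInstance, inferInstance,
    fun s₁ s₂ s₃ F₁ F₂ F₃ hF₁ hF₂ hF₃ => ?_, by rwa [huniv, huniv], by rwa [huniv, huniv]⟩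
  have hpre : e ⁻¹' {l | l.1 s₁ ∈ F₁ ∧ l.2.1 s₂ ∈ F₂ ∧ l.2.2 s₃ ∈ F₃}
      = {l | l.1 s₂ ∈ F₂ ∧ l.2.1 s₃ ∈ F₃ ∧ l.2.2 s₁ ∈ F₁} := by
    ext l
    simp only [e, mem_preimage, mem_ofPred_eq]
    tauto
  have hmeas := measurableSet_coords₃ hF₁ hF₂ hF₃ s₁ s₂ s₃
  rw [map_measureReal_apply he hmeas, map_measureReal_apply he hmeas, hpre,
    h1 s₂ s₃ s₁ F₂ F₃ F₁ hF₂ hF₃ hF₁]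

end Coordinates

namespace IsNormalFunctional₃

variable {E : (H₁ →L[ℂ] H₁) → (H₂ →L[ℂ] H₂) → (H₃ →L[ℂ] H₃) → ℝ}

/-- Together with `rotate`, this brings any two parties into the first two places, so one
construction serves all three pairs. -/
theorem swap (hE : IsNormalFunctional₃ E) : IsNormalFunctional₃ fun A C B => E A B C where
  add₁ A A' C B := hE.add₁ A A' B C
  add₂ A C C' B := hE.add₃ A B C C'
  add₃ A C B B' := hE.add₂ A B B' C
  one := hE.one
  measure₁ hN hC hB := hE.measure₁ hN hB hC
  measure₂ hA hN hB := hE.measure₃ hA hB hN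
  measure₃ hA hC hN := hE.measure₂ hA hN hC

theorem rotate (hE : IsNormalFunctional₃ E) : IsNormalFunctional₃ fun B C A => E A B C where
  add₁ B B' C A := hE.add₂ A B B' C
  add₂ B C C' A := hE.add₃ A B C C'
  add₃ B C A A' := hE.add₁ A A' B C
  one := hE.one
  measure₁ hN hC hA := hE.measure₂ hA hN hC
  measure₂ hB hN hA := hE.measure₃ hA hB hN
  measure₃ hB hC hN := hE.measure₁ hN hB hC

theorem nontrivial_left (hE : IsNormalFunctional₃ E) : Nontrivial H₁ := by
  by_contra h
  have : Subsingleton H₁ := not_nontrivial_iff_subsingleton.mp h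
  have h0 := hE.add₁ 0 0 (ContinuousLinearMap.id ℂ H₂) (ContinuousLinearMap.id ℂ H₃)
  have h1 := hE.one
  rw [Subsingleton.elim (ContinuousLinearMap.id ℂ H₁) 0] at h1
  rw [add_zero, h1] at h0
  norm_num at h0

variable {S₁ S₂ S₃ : ℕ} {Λ₁ Λ₂ Λ₃ : Type} [MeasurableSpace Λ₁] [MeasurableSpace Λ₂]
  [MeasurableSpace Λ₃]

theorem exists_measure_prod (hE : IsNormalFunctional₃ E) {X₁ X₂ : Type} [MeasurableSpace X₁]
    [MeasurableSpace X₂] [StandardBorelSpace X₂] [Nonempty X₂]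
    {N₁ : Set X₁ → (H₁ →L[ℂ] H₁)} (hN₁ : IsOpMeasure N₁)
    {N₂ : Set X₂ → (H₂ →L[ℂ] H₂)} (hN₂ : IsOpMeasure N₂) {C : H₃ →L[ℂ] H₃} (hC : C.IsPositive) :
    ∃ μ : Measure (X₁ × X₂), IsFiniteMeasure μ ∧ ∀ G₁ G₂, MeasurableSet G₁ → MeasurableSet G₂ →
      μ.real (G₁ ×ˢ G₂) = E (N₁ G₁) (N₂ G₂) C :=
  IsBimeasure.exists_measure ⟨fun F hF => hE.measure₁ hN₁ (hN₂.positive F hF) hC,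
    fun G hG => hE.measure₂ (hN₁.positive G hG) hN₂ hC⟩

/-- Two successive gluings. For each event `F` of the third party, the bimeasure in `G₁`, `G₂`
extends to a measure `β s F` on `X₁ × X₂`. Then `β s` is itself a bimeasure on `(X₁ × X₂) × Λ₃`,
with a first marginal independent of `s`. -/
theorem exists_measure (hE : IsNormalFunctional₃ E) [StandardBorelSpace Λ₃] [Nonempty Λ₃]
    {X₁ X₂ : Type} [MeasurableSpace X₁] [MeasurableSpace X₂] [StandardBorelSpace X₂] [Nonempty X₂]
    {N₁ : Set X₁ → (H₁ →L[ℂ] H₁)} (hN₁ : IsOpMeasure N₁)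
    {N₂ : Set X₂ → (H₂ →L[ℂ] H₂)} (hN₂ : IsOpMeasure N₂) (M : Fin S₃ → POVMeasure Λ₃ H₃) :
    ∃ μ : Measure (X₁ × X₂ × (Fin S₃ → Λ₃)), IsFiniteMeasure μ ∧
      ∀ s G₁ G₂ F, MeasurableSet G₁ → MeasurableSet G₂ → MeasurableSet F →
        μ.real {p | p.1 ∈ G₁ ∧ p.2.1 ∈ G₂ ∧ p.2.2 s ∈ F} = E (N₁ G₁) (N₂ G₂) ((M s).op F) := by
  have hβ : ∀ s F, ∃ μ : Measure (X₁ × X₂), IsFiniteMeasure μ ∧ (MeasurableSet F →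
      ∀ G₁ G₂, MeasurableSet G₁ → MeasurableSet G₂ →
        μ.real (G₁ ×ˢ G₂) = E (N₁ G₁) (N₂ G₂) ((M s).op F)) := fun s F => by
    by_cases hF : MeasurableSet F
    · obtain ⟨μ, h1, h2⟩ := hE.exists_measure_prod hN₁ hN₂ ((M s).positive F hF)
      exact ⟨μ, h1, fun _ => h2⟩
    · exact ⟨0, inferInstance, fun h => absurd h hF⟩
  choose β hβfin hβ using hβ
  obtain ⟨m, hm, hmE⟩ :=
    hE.exists_measure_prod hN₁ hN₂ (ContinuousLinearMap.isPositive_id (E := H₃))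
  have hext : ∀ μ ν : Measure (X₁ × X₂), IsFiniteMeasure μ → IsFiniteMeasure ν →
      (∀ G₁ G₂, MeasurableSet G₁ → MeasurableSet G₂ → μ.real (G₁ ×ˢ G₂) = ν.real (G₁ ×ˢ G₂)) →
      μ = ν := fun μ ν _ _ h => by
    refine Measure.ext_prod fun {s t} hs ht => ?_
    rw [← ENNReal.toReal_eq_toReal_iff' (measure_ne_top _ _) (measure_ne_top _ _)]
    exact h s t hs ht
  have hβuniv : ∀ s, β s univ = m := fun s => hext _ _ inferInstance hm fun G₁ G₂ h₁ h₂ => by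
    rw [hβ s univ MeasurableSet.univ G₁ G₂ h₁ h₂, hmE G₁ G₂ h₁ h₂, (M s).op_univ]
  have hright : ∀ s G, MeasurableSet G → IsRealMeasure fun F => (β s F).real G := fun s G hG =>
    ⟨fun F _ => measureReal_nonneg, fun F hF hd => by
      have hrect : ∀ G₁ G₂, MeasurableSet G₁ → MeasurableSet G₂ →
          HasSum (fun i => (β s (F i)).real (G₁ ×ˢ G₂)) ((β s (⋃ i, F i)).real (G₁ ×ˢ G₂)) :=
        fun G₁ G₂ h₁ h₂ => by
          simp only [hβ s _ (hF _) G₁ G₂ h₁ h₂, hβ s _ (MeasurableSet.iUnion hF) G₁ G₂ h₁ h₂]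
          exact (hE.measure₃ (hN₁.positive G₁ h₁) (hN₂.positive G₂ h₂)
            (M s).isOpMeasure).hasSum F hF hd
      have hsum : ∀ G₁ G₂, MeasurableSet G₁ → MeasurableSet G₂ →
          Measure.sum (fun i => β s (F i)) (G₁ ×ˢ G₂) = β s (⋃ i, F i) (G₁ ×ˢ G₂) :=
        fun G₁ G₂ h₁ h₂ => by
          have h := hrect G₁ G₂ h₁ h₂
          have h' := congrArg ENNReal.ofReal h.tsum_eq
          rw [ENNReal.ofReal_tsum_of_nonneg (fun _ => measureReal_nonneg) h.summable,
            ofReal_measureReal] at h'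
          rw [Measure.sum_apply _ (h₁.prod h₂), ← h']
          exact tsum_congr fun i => (ofReal_measureReal (measure_ne_top _ _)).symm
      -- Additivity in `F` is known only on rectangles; uniqueness of measures on a product extends
      -- it to all measurable sets.
      have heq : Measure.sum (fun i => β s (F i)) = β s (⋃ i, F i) :=
        (Measure.ext_prod fun {s t} hs ht => (hsum s t hs ht).symm).symm
      rw [← heq]
      have h : Measure.sum (fun i => β s (F i)) G = ∑' i, β s (F i) G := Measure.sum_apply _ hG
      have hfin : ∑' i, β s (F i) G ≠ ∞ := by
        rw [← h, heq]
        exact measure_ne_top _ _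
      rw [measureReal_def, h, ENNReal.tsum_toReal_eq fun i => measure_ne_top _ _]
      exact ENNReal.hasSum_toReal hfin⟩
  obtain ⟨μ, hμ, h⟩ := exists_measure_prod_pi (b := fun s G F => (β s F).real G)
    (fun s => ⟨fun F _ => IsRealMeasure.of_measure (β s F), hright s⟩) m
    (fun s G _ => by rw [hβuniv s])
  refine ⟨μ.map MeasurableEquiv.prodAssoc, inferInstance, fun s G₁ G₂ F h₁ h₂ hF => ?_⟩
  have hmeas : MeasurableSet {p : X₁ × X₂ × (Fin S₃ → Λ₃) | p.1 ∈ G₁ ∧ p.2.1 ∈ G₂ ∧ p.2.2 s ∈ F} :=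
    h₁.prod (h₂.prod (measurable_pi_apply s hF))
  rw [map_measureReal_apply MeasurableEquiv.prodAssoc.measurable hmeas, ← hβ s F hF G₁ G₂ h₁ h₂,
    ← h s _ F (h₁.prod h₂) hF]
  congr 1
  ext p
  exact and_assoc.symm

/-- Expand `(P - Q) ⊗ (P' - Q')`: equal signs make up the positive part, mixed signs the negative
part. The total mass is that of `(P + Q) ⊗ (P' + Q')`, hence the product of the two bipartite
constants. -/
theorem hasQuasiModel (hE : IsNormalFunctional₃ E) [StandardBorelSpace Λ₂] [Nonempty Λ₂]
    [StandardBorelSpace Λ₃] [Nonempty Λ₃] (hS₁ : 1 ≤ S₁) (hS₂ : 1 ≤ S₂) (hS₃ : 1 ≤ S₃)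
    (M₁ : Fin S₁ → POVMeasure Λ₁ H₁) (M₂ : Fin S₂ → POVMeasure Λ₂ H₂)
    (M₃ : Fin S₃ → POVMeasure Λ₃ H₃) {k₁ k₂ : ℕ} {P Q P' Q'} (h₁ : IsQuasiJoint M₁ k₁ P Q)
    (h₂ : IsQuasiJoint M₂ k₂ P' Q') :
    HasQuasiModel₃ (fun s₁ s₂ s₃ F₁ F₂ F₃ => E ((M₁ s₁).op F₁) ((M₂ s₂).op F₂) ((M₃ s₃).op F₃))
      ((2 * k₁ + 1) * (2 * k₂ + 1)) := by
  obtain ⟨μpp, _, hpp⟩ := hE.exists_measure h₁.pos h₂.pos M₃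
  obtain ⟨μpm, _, hpm⟩ := hE.exists_measure h₁.pos h₂.neg M₃
  obtain ⟨μmp, _, hmp⟩ := hE.exists_measure h₁.neg h₂.pos M₃
  obtain ⟨μmm, _, hmm⟩ := hE.exists_measure h₁.neg h₂.neg M₃
  have huniv : ∀ {N₁ : Set (Fin S₁ → Λ₁) → (H₁ →L[ℂ] H₁)} {N₂ : Set (Fin S₂ → Λ₂) → (H₂ →L[ℂ] H₂)}
      {μ : Measure ((Fin S₁ → Λ₁) × (Fin S₂ → Λ₂) × (Fin S₃ → Λ₃))} {n₁ n₂ : ℕ},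
      (∀ s G₁ G₂ F, MeasurableSet G₁ → MeasurableSet G₂ → MeasurableSet F →
        μ.real {p | p.1 ∈ G₁ ∧ p.2.1 ∈ G₂ ∧ p.2.2 s ∈ F}
          = E (N₁ G₁) (N₂ G₂) ((M₃ s).op F)) →
      N₁ univ = n₁ • ContinuousLinearMap.id ℂ H₁ → N₂ univ = n₂ • ContinuousLinearMap.id ℂ H₂ →
      μ.real univ = n₁ * n₂ := fun {N₁ N₂ μ n₁ n₂} h e₁ e₂ => by
    have h := h ⟨0, hS₃⟩ univ univ univ MeasurableSet.univ MeasurableSet.univ MeasurableSet.univ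
    rw [(M₃ _).op_univ, e₁, e₂, apply_nsmul_of_additive (e := fun A => E A _ _)
      (fun A B => hE.add₁ A B _ _), apply_nsmul_of_additive (e := fun A => E _ A _)
      (fun A B => hE.add₂ _ A B _), hE.one, mul_one] at h
    simpa using h
  have hP : P univ = (k₁ + 1) • ContinuousLinearMap.id ℂ H₁ := by
    have h := h₁.marginal ⟨0, hS₁⟩ univ MeasurableSet.univ
    simp only [mem_univ, ofPred_true, (M₁ _).op_univ, h₁.total] at h
    rw [h, succ_nsmul']
  have hP' : P' univ = (k₂ + 1) • ContinuousLinearMap.id ℂ H₂ := by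
    have h := h₂.marginal ⟨0, hS₂⟩ univ MeasurableSet.univ
    simp only [mem_univ, ofPred_true, (M₂ _).op_univ, h₂.total] at h
    rw [h, succ_nsmul']
  have e1 := huniv hpp hP hP'
  have e2 := huniv hpm hP h₂.total
  have e3 := huniv hmp h₁.total hP'
  have e4 := huniv hmm h₁.total h₂.total
  refine ⟨μpp + μmm, μpm + μmp, inferInstance, inferInstance,
    fun s₁ s₂ s₃ F₁ F₂ F₃ hF₁ hF₂ hF₃ => ?_, ?_, ?_⟩
  · have hG₁ : MeasurableSet {l : Fin S₁ → Λ₁ | l s₁ ∈ F₁} := measurable_pi_apply s₁ hF₁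
    have hG₂ : MeasurableSet {l : Fin S₂ → Λ₂ | l s₂ ∈ F₂} := measurable_pi_apply s₂ hF₂
    have d1 := hpp s₃ _ _ F₃ hG₁ hG₂ hF₃
    have d2 := hpm s₃ _ _ F₃ hG₁ hG₂ hF₃
    have d3 := hmp s₃ _ _ F₃ hG₁ hG₂ hF₃
    have d4 := hmm s₃ _ _ F₃ hG₁ hG₂ hF₃
    simp only [h₁.marginal s₁ F₁ hF₁, h₂.marginal s₂ F₂ hF₂, hE.add₁, hE.add₂, mem_ofPred_eq]
      at d1 d2 d3 d4
    rw [measureReal_add_apply, measureReal_add_apply, d1, d2, d3, d4]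
    ring
  · rw [measureReal_add_apply, measureReal_add_apply, e1, e2, e3, e4]
    push_cast
    ring
  · rw [measureReal_add_apply, measureReal_add_apply, e1, e2, e3, e4]
    push_cast
    ring

end IsNormalFunctional₃

end Tripartite

/-! ### Bounds on the maximal violation -/

theorem one_le_of_hilbertDim_eq {H : Type*} [NormedAddCommGroup H] [InnerProductSpace ℂ H]
    [Nontrivial H] {a : ℕ} (h : hilbertDim H = a) : 1 ≤ a := by
  by_contra h0
  obtain rfl : a = 0 := by omega
  have h' : Module.rank ℂ H = (0 : ℕ) := Cardinal.toENat_eq_natCast.mp h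
  rw [Nat.cast_zero, rank_zero_iff] at h'
  exact not_subsingleton H h'

theorem EReal.coe_ennreal_le_of_le_ofReal {x : ℝ≥0∞} {K : ℝ} (hK : 0 ≤ K)
    (h : x ≤ ENNReal.ofReal K) : (x : EReal) ≤ (K : EReal) := by
  have h' : (x : EReal) ≤ ((ENNReal.ofReal K : ℝ≥0∞) : EReal) :=
    EReal.coe_ennreal_le_coe_ennreal_iff.mpr h
  rwa [EReal.coe_ennreal_ofReal, max_eq_left hK] at h'

section Bipartite

variable {H₁ H₂ : Type*} [NormedAddCommGroup H₁] [InnerProductSpace ℂ H₁] [CompleteSpace H₁]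
  [NormedAddCommGroup H₂] [InnerProductSpace ℂ H₂] [CompleteSpace H₂]
  {ρ : HilbertTensor H₁ H₂ →L[ℂ] HilbertTensor H₁ H₂}

theorem IsState.isNormalFunctional₂ (hρ : IsState ρ) :
    IsNormalFunctional₂ fun (A : H₁ →L[ℂ] H₁) (B : H₂ →L[ℂ] H₂) => stateExp ρ (opTensor A B) where
  add₁ A A' B := by rw [opTensor_add_left, hρ.stateExp_add]
  add₂ A B B' := by rw [opTensor_add_right, hρ.stateExp_add]
  one := by rw [opTensor_id, hρ.stateExp_one]
  measure₁ hN hB := hρ.isRealMeasure (hN.opTensor_left hB)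
  measure₂ hA hN := hρ.isRealMeasure (hN.opTensor_right hA)

theorem scenarioParam₂_le (hρ : IsState ρ) {S₁ S₂ : ℕ} {Λ₁ Λ₂ : Type} [MeasurableSpace Λ₁]
    [MeasurableSpace Λ₂] (M₁ : Fin S₁ → POVMeasure Λ₁ H₁) (M₂ : Fin S₂ → POVMeasure Λ₂ H₂) {K : ℝ}
    (h : HasQuasiModel₂
      (fun s₁ s₂ F₁ F₂ => stateExp ρ (opTensor ((M₁ s₁).op F₁) ((M₂ s₂).op F₂))) K) :
    scenarioParam₂ ρ M₁ M₂ ≤ ENNReal.ofReal K := by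
  obtain ⟨μp, μm, _, _, h1, h2, rfl⟩ := h
  refine (iInf₂_le (μp.toSignedMeasure - μm.toSignedMeasure)
    ⟨?_, fun s₁ s₂ F₁ F₂ hF₁ hF₂ => ?_⟩).trans (totalVariation_sub_le μp μm)
  · rw [Measure.toSignedMeasure_sub_apply MeasurableSet.univ, h2, add_sub_cancel_right]
  · rw [Measure.toSignedMeasure_sub_apply (measurableSet_coords₂ hF₁ hF₂ s₁ s₂),
      h1 s₁ s₂ F₁ F₂ hF₁ hF₂, add_sub_cancel_right]
    exact hρ.coe_stateExp (opTensor_isPositive ((M₁ s₁).positive F₁ hF₁) ((M₂ s₂).positive F₂ hF₂))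

theorem maxViolation₂_le_of_hasQuasiModel (hρ : IsState ρ) {S₁ S₂ : ℕ} (hS₁ : 1 ≤ S₁)
    (hS₂ : 1 ≤ S₂) {K : ℝ}
    (h : ∀ (Λ₁ Λ₂ : Type) [MeasurableSpace Λ₁] [MeasurableSpace Λ₂] [StandardBorelSpace Λ₁]
      [StandardBorelSpace Λ₂] [Nonempty Λ₁] [Nonempty Λ₂] (M₁ : Fin S₁ → POVMeasure Λ₁ H₁)
      (M₂ : Fin S₂ → POVMeasure Λ₂ H₂), HasQuasiModel₂
        (fun s₁ s₂ F₁ F₂ => stateExp ρ (opTensor ((M₁ s₁).op F₁) ((M₂ s₂).op F₂))) K) :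
    maxViolation₂ ρ S₁ S₂ ≤ ENNReal.ofReal K := by
  -- Trace one forces both Hilbert spaces to be nonzero, hence all outcome spaces to be nonempty.
  have := hρ.isNormalFunctional₂.nontrivial_left
  have := hρ.isNormalFunctional₂.swap.nontrivial_left
  refine iSup_le fun Λ₁ => iSup_le fun Λ₂ => iSup_le fun _ => iSup_le fun _ => iSup_le fun _ =>
    iSup_le fun _ => iSup_le fun M₁ => iSup_le fun M₂ => ?_
  have := (M₁ ⟨0, hS₁⟩).nonempty
  have := (M₂ ⟨0, hS₂⟩).nonempty
  exact scenarioParam₂_le hρ M₁ M₂ (h Λ₁ Λ₂ M₁ M₂)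

/-- The disjunction lets `a` be any finite one of `S₁`, `S₂`, `d₁`, `d₂`, so the bound by their
minimum follows from a single estimate. -/
theorem maxViolation₂_le (hρ : IsState ρ) {S₁ S₂ : ℕ} (hS₁ : 1 ≤ S₁) (hS₂ : 1 ≤ S₂) {a : ℕ}
    (ha : (a = S₁ ∨ hilbertDim H₁ = a) ∨ (a = S₂ ∨ hilbertDim H₂ = a)) :
    (maxViolation₂ ρ S₁ S₂ : EReal) ≤ ((2 * a - 1 : ℝ) : EReal) := by
  have hE := hρ.isNormalFunctional₂
  have := hE.nontrivial_left
  have := hE.swap.nontrivial_left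
  have ha1 : 1 ≤ a := by
    rcases ha with (rfl | h) | (rfl | h)
    exacts [hS₁, one_le_of_hilbertDim_eq h, hS₂, one_le_of_hilbertDim_eq h]
  have hK : (2 * a - 1 : ℝ) = 2 * ((a - 1 : ℕ) : ℝ) + 1 := by
    rw [Nat.cast_sub ha1]
    push_cast
    ring
  rw [hK]
  refine EReal.coe_ennreal_le_of_le_ofReal (by positivity)
    (maxViolation₂_le_of_hasQuasiModel hρ hS₁ hS₂ fun Λ₁ Λ₂ _ _ _ _ _ _ M₁ M₂ => ?_)
  rcases ha with ha | ha
  · obtain ⟨_, _, h⟩ := exists_isQuasiJoint hS₁ M₁ ha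
    exact hE.hasQuasiModel hS₁ hS₂ M₁ M₂ h
  · obtain ⟨_, _, h⟩ := exists_isQuasiJoint hS₂ M₂ ha
    exact (hE.swap.hasQuasiModel hS₂ hS₁ M₂ M₁ h).swap

end Bipartite

section Tripartite

variable {H₁ H₂ H₃ : Type*} [NormedAddCommGroup H₁] [InnerProductSpace ℂ H₁] [CompleteSpace H₁]
  [NormedAddCommGroup H₂] [InnerProductSpace ℂ H₂] [CompleteSpace H₂]
  [NormedAddCommGroup H₃] [InnerProductSpace ℂ H₃] [CompleteSpace H₃]
  {ρ : HilbertTensor₃ H₁ H₂ H₃ →L[ℂ] HilbertTensor₃ H₁ H₂ H₃}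

theorem IsState.isNormalFunctional₃ (hρ : IsState ρ) :
    IsNormalFunctional₃ fun (A : H₁ →L[ℂ] H₁) (B : H₂ →L[ℂ] H₂) (C : H₃ →L[ℂ] H₃) =>
      stateExp ρ (opTensor (opTensor A B) C) where
  add₁ A A' B C := by rw [opTensor_add_left, opTensor_add_left, hρ.stateExp_add]
  add₂ A B B' C := by rw [opTensor_add_right, opTensor_add_left, hρ.stateExp_add]
  add₃ A B C C' := by rw [opTensor_add_right, hρ.stateExp_add]
  one := by rw [opTensor_id, opTensor_id, hρ.stateExp_one]
  measure₁ hN hB hC := hρ.isRealMeasure ((hN.opTensor_left hB).opTensor_left hC)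
  measure₂ hA hN hC := hρ.isRealMeasure ((hN.opTensor_right hA).opTensor_left hC)
  measure₃ hA hB hN := hρ.isRealMeasure (hN.opTensor_right (opTensor_isPositive hA hB))

theorem scenarioParam₃_le (hρ : IsState ρ) {S₁ S₂ S₃ : ℕ} {Λ₁ Λ₂ Λ₃ : Type} [MeasurableSpace Λ₁]
    [MeasurableSpace Λ₂] [MeasurableSpace Λ₃] (M₁ : Fin S₁ → POVMeasure Λ₁ H₁)
    (M₂ : Fin S₂ → POVMeasure Λ₂ H₂) (M₃ : Fin S₃ → POVMeasure Λ₃ H₃) {K : ℝ}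
    (h : HasQuasiModel₃ (fun s₁ s₂ s₃ F₁ F₂ F₃ =>
      stateExp ρ (opTensor (opTensor ((M₁ s₁).op F₁) ((M₂ s₂).op F₂)) ((M₃ s₃).op F₃))) K) :
    scenarioParam₃ ρ M₁ M₂ M₃ ≤ ENNReal.ofReal K := by
  obtain ⟨μp, μm, _, _, h1, h2, rfl⟩ := h
  refine (iInf₂_le (μp.toSignedMeasure - μm.toSignedMeasure)
    ⟨?_, fun s₁ s₂ s₃ F₁ F₂ F₃ hF₁ hF₂ hF₃ => ?_⟩).trans (totalVariation_sub_le μp μm)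
  · rw [Measure.toSignedMeasure_sub_apply MeasurableSet.univ, h2, add_sub_cancel_right]
  · rw [Measure.toSignedMeasure_sub_apply (measurableSet_coords₃ hF₁ hF₂ hF₃ s₁ s₂ s₃),
      h1 s₁ s₂ s₃ F₁ F₂ F₃ hF₁ hF₂ hF₃, add_sub_cancel_right]
    exact hρ.coe_stateExp (opTensor_isPositive (opTensor_isPositive ((M₁ s₁).positive F₁ hF₁)
      ((M₂ s₂).positive F₂ hF₂)) ((M₃ s₃).positive F₃ hF₃))

theorem maxViolation₃_le_of_hasQuasiModel (hρ : IsState ρ) {S₁ S₂ S₃ : ℕ} (hS₁ : 1 ≤ S₁)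
    (hS₂ : 1 ≤ S₂) (hS₃ : 1 ≤ S₃) {K : ℝ}
    (h : ∀ (Λ₁ Λ₂ Λ₃ : Type) [MeasurableSpace Λ₁] [MeasurableSpace Λ₂] [MeasurableSpace Λ₃]
      [StandardBorelSpace Λ₁] [StandardBorelSpace Λ₂] [StandardBorelSpace Λ₃] [Nonempty Λ₁]
      [Nonempty Λ₂] [Nonempty Λ₃] (M₁ : Fin S₁ → POVMeasure Λ₁ H₁)
      (M₂ : Fin S₂ → POVMeasure Λ₂ H₂) (M₃ : Fin S₃ → POVMeasure Λ₃ H₃),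
      HasQuasiModel₃ (fun s₁ s₂ s₃ F₁ F₂ F₃ =>
        stateExp ρ (opTensor (opTensor ((M₁ s₁).op F₁) ((M₂ s₂).op F₂)) ((M₃ s₃).op F₃))) K) :
    maxViolation₃ ρ S₁ S₂ S₃ ≤ ENNReal.ofReal K := by
  have := hρ.isNormalFunctional₃.nontrivial_left
  have := hρ.isNormalFunctional₃.rotate.nontrivial_left
  have := hρ.isNormalFunctional₃.rotate.rotate.nontrivial_left
  refine iSup_le fun Λ₁ => iSup_le fun Λ₂ => iSup_le fun Λ₃ => iSup_le fun _ => iSup_le fun _ =>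
    iSup_le fun _ => iSup_le fun _ => iSup_le fun _ => iSup_le fun _ =>
    iSup_le fun M₁ => iSup_le fun M₂ => iSup_le fun M₃ => ?_
  have := (M₁ ⟨0, hS₁⟩).nonempty
  have := (M₂ ⟨0, hS₂⟩).nonempty
  have := (M₃ ⟨0, hS₃⟩).nonempty
  exact scenarioParam₃_le hρ M₁ M₂ M₃ (h Λ₁ Λ₂ Λ₃ M₁ M₂ M₃)

theorem maxViolation₃_le (hρ : IsState ρ) {S₁ S₂ S₃ : ℕ} (hS₁ : 1 ≤ S₁) (hS₂ : 1 ≤ S₂)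
    (hS₃ : 1 ≤ S₃) {a b : ℕ}
    (h : (a = S₁ ∨ hilbertDim H₁ = a) ∧ (b = S₂ ∨ hilbertDim H₂ = b) ∨
      (a = S₁ ∨ hilbertDim H₁ = a) ∧ (b = S₃ ∨ hilbertDim H₃ = b) ∨
      (a = S₂ ∨ hilbertDim H₂ = a) ∧ (b = S₃ ∨ hilbertDim H₃ = b)) :
    (maxViolation₃ ρ S₁ S₂ S₃ : EReal) ≤ (((2 * a - 1) * (2 * b - 1) : ℝ) : EReal) := by
  have hE := hρ.isNormalFunctional₃
  have := hE.nontrivial_left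
  have := hE.rotate.nontrivial_left
  have := hE.rotate.rotate.nontrivial_left
  have ha1 : 1 ≤ a := by
    rcases h with ⟨rfl | h, _⟩ | ⟨rfl | h, _⟩ | ⟨rfl | h, _⟩
    all_goals first | assumption | exact one_le_of_hilbertDim_eq h
  have hb1 : 1 ≤ b := by
    rcases h with ⟨_, rfl | h⟩ | ⟨_, rfl | h⟩ | ⟨_, rfl | h⟩
    all_goals first | assumption | exact one_le_of_hilbertDim_eq h
  have hK : ((2 * a - 1) * (2 * b - 1) : ℝ)
      = (2 * ((a - 1 : ℕ) : ℝ) + 1) * (2 * ((b - 1 : ℕ) : ℝ) + 1) := by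
    rw [Nat.cast_sub ha1, Nat.cast_sub hb1]
    push_cast
    ring
  rw [hK]
  refine EReal.coe_ennreal_le_of_le_ofReal (by positivity)
    (maxViolation₃_le_of_hasQuasiModel hρ hS₁ hS₂ hS₃ fun Λ₁ Λ₂ Λ₃ _ _ _ _ _ _ _ _ _ M₁ M₂ M₃ => ?_)
  rcases h with ⟨ha, hb⟩ | ⟨ha, hb⟩ | ⟨ha, hb⟩
  · obtain ⟨_, _, h₁⟩ := exists_isQuasiJoint hS₁ M₁ ha
    obtain ⟨_, _, h₂⟩ := exists_isQuasiJoint hS₂ M₂ hb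
    exact hE.hasQuasiModel hS₁ hS₂ hS₃ M₁ M₂ M₃ h₁ h₂
  · obtain ⟨_, _, h₁⟩ := exists_isQuasiJoint hS₁ M₁ ha
    obtain ⟨_, _, h₃⟩ := exists_isQuasiJoint hS₃ M₃ hb
    exact (hE.swap.hasQuasiModel hS₁ hS₃ hS₂ M₁ M₃ M₂ h₁ h₃).swap
  · obtain ⟨_, _, h₂⟩ := exists_isQuasiJoint hS₂ M₂ ha
    obtain ⟨_, _, h₃⟩ := exists_isQuasiJoint hS₃ M₃ hb
    exact (hE.rotate.hasQuasiModel hS₂ hS₃ hS₁ M₂ M₃ M₁ h₂ h₃).rotate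

end Tripartite

/-! ### Arithmetic in the extended reals and the final bounds -/

theorem ENat.toExtReal_natCast (n : ℕ) : ENat.toExtReal n = ((n : ℝ) : EReal) := by
  rw [ENat.toExtReal, ENat.toENNReal_coe, ← ENNReal.ofReal_natCast, EReal.coe_ennreal_ofReal,
    max_eq_left n.cast_nonneg]

theorem ENat.toExtReal_top : ENat.toExtReal ⊤ = ⊤ := by
  simp [ENat.toExtReal]

theorem ENat.toExtReal_mul (a b : ℕ∞) :
    ENat.toExtReal (a * b) = ENat.toExtReal a * ENat.toExtReal b := by
  simp [ENat.toExtReal]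

/-- For `n = ⊤` the right-hand side is `⊤`, so only finite values carry content. -/
theorem le_two_mul_toExtReal_sub_one {x : EReal} {n : ℕ∞}
    (h : ∀ j : ℕ, n = j → x ≤ ((2 * j - 1 : ℝ) : EReal)) : x ≤ 2 * ENat.toExtReal n - 1 := by
  induction n using ENat.recTopCoe with
  | top =>
    rw [ENat.toExtReal_top, show (2 : EReal) = ((2 : ℝ) : EReal) from rfl,
      EReal.coe_mul_top_of_pos two_pos]
    exact le_top
  | coe j =>
    have h' := h j rfl
    rwa [EReal.coe_sub, EReal.coe_mul] at h'

/-- `(2a - 1)(2b - 1) ≤ 4ab - 3` amounts to `a + b ≥ 2`. The lower bounds on `m` and `n` also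
exclude the product `0 * ⊤ = 0`. -/
theorem le_four_mul_toExtReal_mul_sub_three {x : EReal} {m n : ℕ∞} (hm : 1 ≤ m) (hn : 1 ≤ n)
    (h : ∀ a b : ℕ, m = a → n = b → x ≤ (((2 * a - 1) * (2 * b - 1) : ℝ) : EReal)) :
    x ≤ 4 * ENat.toExtReal (m * n) - 3 := by
  have htop : x ≤ 4 * ENat.toExtReal ⊤ - 3 := by
    rw [ENat.toExtReal_top, show (4 : EReal) = ((4 : ℝ) : EReal) from rfl,
      EReal.coe_mul_top_of_pos four_pos]
    exact le_top
  induction m using ENat.recTopCoe with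
  | top => rwa [ENat.top_mul (one_pos.trans_le hn).ne']
  | coe a =>
    induction n using ENat.recTopCoe with
    | top => rwa [ENat.mul_top (one_pos.trans_le hm).ne']
    | coe b =>
      have ha : (1 : ℝ) ≤ a := by exact_mod_cast hm
      have hb : (1 : ℝ) ≤ b := by exact_mod_cast hn
      rw [← Nat.cast_mul, ENat.toExtReal_natCast]
      have hle : ((2 * a - 1) * (2 * b - 1) : ℝ) ≤ 4 * ((a * b : ℕ) : ℝ) - 3 := by
        push_cast
        linarith
      refine (h a b rfl rfl).trans ((EReal.coe_le_coe_iff.mpr hle).trans_eq ?_)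
      rw [EReal.coe_sub, EReal.coe_mul]
      rfl

theorem four_mul_sub_two_mul_add_one (a b : ℕ) :
    4 * (a : EReal) * b - 2 * ((a : EReal) + b) + 1
      = (((2 * a - 1) * (2 * b - 1) : ℝ) : EReal) := by
  rw [show ((2 * a - 1) * (2 * b - 1) : ℝ) = 4 * a * b - 2 * (a + b) + 1 by ring]
  simp only [EReal.coe_sub, EReal.coe_mul, EReal.coe_add, EReal.coe_natCast]
  rfl

theorem settings_bound_le {a b : ℕ} (ha : 1 ≤ a) (hb : 1 ≤ b) :
    (((2 * a - 1) * (2 * b - 1) : ℝ) : EReal) ≤ 4 * ENat.toExtReal (a * b) - 3 :=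
  le_four_mul_toExtReal_mul_sub_three (by exact_mod_cast ha) (by exact_mod_cast hb)
    fun a' b' h₁ h₂ => by rw [Nat.cast_inj.mp h₁, Nat.cast_inj.mp h₂]

theorem prodDivMax_choice (a b c : ℕ∞) :
    prodDivMax a b c = a * b ∨ prodDivMax a b c = a * c ∨ prodDivMax a b c = b * c := by
  rw [prodDivMax]
  rcases min_choice (a * b) (min (a * c) (b * c)) with h | h
  · exact Or.inl h
  · rw [h]
    exact Or.inr (min_choice _ _)

theorem one_le_hilbertDim {H : Type*} [NormedAddCommGroup H] [InnerProductSpace ℂ H]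
    [Nontrivial H] : 1 ≤ hilbertDim H := by
  induction h : hilbertDim H using ENat.recTopCoe with
  | top => exact le_top
  | coe a => exact_mod_cast one_le_of_hilbertDim_eq h

theorem corollary3 :
    -- bipartite states
    (∀ (H₁ : Type*) (H₂ : Type*)
      [NormedAddCommGroup H₁] [InnerProductSpace ℂ H₁] [CompleteSpace H₁]
      [TopologicalSpace.SeparableSpace H₁]
      [NormedAddCommGroup H₂] [InnerProductSpace ℂ H₂] [CompleteSpace H₂]
      [TopologicalSpace.SeparableSpace H₂]
      (ρ : HilbertTensor H₁ H₂ →L[ℂ] HilbertTensor H₁ H₂), IsState ρ →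
      (∀ S₁ S₂ : ℕ, 1 ≤ S₁ → 1 ≤ S₂ →
        (maxViolation₂ ρ S₁ S₂ : EReal) ≤
          2 * ENat.toExtReal (min (min S₁ S₂) (min (hilbertDim H₁) (hilbertDim H₂))) - 1) ∧
      (∀ (S : ℕ) (d : ℕ∞), 1 ≤ S → hilbertDim H₁ = d → hilbertDim H₂ = d →
        (maxViolation₂ ρ S S : EReal) ≤ 2 * ENat.toExtReal (min S d) - 1)) ∧
    -- tripartite states
    (∀ (H₁ : Type*) (H₂ : Type*) (H₃ : Type*)
      [NormedAddCommGroup H₁] [InnerProductSpace ℂ H₁] [CompleteSpace H₁]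
      [TopologicalSpace.SeparableSpace H₁]
      [NormedAddCommGroup H₂] [InnerProductSpace ℂ H₂] [CompleteSpace H₂]
      [TopologicalSpace.SeparableSpace H₂]
      [NormedAddCommGroup H₃] [InnerProductSpace ℂ H₃] [CompleteSpace H₃]
      [TopologicalSpace.SeparableSpace H₃]
      (ρ : HilbertTensor₃ H₁ H₂ H₃ →L[ℂ] HilbertTensor₃ H₁ H₂ H₃), IsState ρ →
      (∀ S₁ S₂ S₃ : ℕ, 1 ≤ S₁ → 1 ≤ S₂ → 1 ≤ S₃ →
        (maxViolation₃ ρ S₁ S₂ S₃ : EReal) ≤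
          min
            (min (4 * (S₁ : EReal) * S₂ - 2 * ((S₁ : EReal) + S₂) + 1)
              (min (4 * (S₁ : EReal) * S₃ - 2 * ((S₁ : EReal) + S₃) + 1)
                (4 * (S₂ : EReal) * S₃ - 2 * ((S₂ : EReal) + S₃) + 1)))
            (4 * ENat.toExtReal (prodDivMax (hilbertDim H₁) (hilbertDim H₂) (hilbertDim H₃)) - 3) ∧
        min
            (min (4 * (S₁ : EReal) * S₂ - 2 * ((S₁ : EReal) + S₂) + 1)
              (min (4 * (S₁ : EReal) * S₃ - 2 * ((S₁ : EReal) + S₃) + 1)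
                (4 * (S₂ : EReal) * S₃ - 2 * ((S₂ : EReal) + S₃) + 1)))
            (4 * ENat.toExtReal (prodDivMax (hilbertDim H₁) (hilbertDim H₂) (hilbertDim H₃)) - 3) ≤
          4 * ENat.toExtReal (min (prodDivMax S₁ S₂ S₃)
            (prodDivMax (hilbertDim H₁) (hilbertDim H₂) (hilbertDim H₃))) - 3) ∧
      (∀ (S : ℕ) (d : ℕ∞), 1 ≤ S → hilbertDim H₁ = d → hilbertDim H₂ = d → hilbertDim H₃ = d →
        (maxViolation₃ ρ S S S : EReal) ≤
          min ((2 * (S : EReal) - 1) ^ 2) (4 * ENat.toExtReal d ^ 2 - 3) ∧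
        min ((2 * (S : EReal) - 1) ^ 2) (4 * ENat.toExtReal d ^ 2 - 3) ≤
          4 * ENat.toExtReal (min S d) ^ 2 - 3)) := by
  refine ⟨fun H₁ H₂ _ _ _ _ _ _ _ _ ρ hρ => ?_, fun H₁ H₂ H₃ _ _ _ _ _ _ _ _ _ _ _ _ ρ hρ => ?_⟩
  · have main : ∀ S₁ S₂ : ℕ, 1 ≤ S₁ → 1 ≤ S₂ → (maxViolation₂ ρ S₁ S₂ : EReal) ≤
        2 * ENat.toExtReal (min (min S₁ S₂) (min (hilbertDim H₁) (hilbertDim H₂))) - 1 :=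
      fun S₁ S₂ hS₁ hS₂ => by
        refine le_two_mul_toExtReal_sub_one fun j hj => maxViolation₂_le hρ hS₁ hS₂ ?_
        rcases min_choice (min (S₁ : ℕ∞) S₂) (min (hilbertDim H₁) (hilbertDim H₂)) with h | h <;>
          rw [h] at hj
        · rcases min_choice (S₁ : ℕ∞) S₂ with h | h <;> rw [h] at hj
          · exact Or.inl (Or.inl (by exact_mod_cast hj.symm))
          · exact Or.inr (Or.inl (by exact_mod_cast hj.symm))
        · rcases min_choice (hilbertDim H₁) (hilbertDim H₂) with h | h <;> rw [h] at hj
          · exact Or.inl (Or.inr hj)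
          · exact Or.inr (Or.inr hj)
    refine ⟨main, fun S d hS h₁ h₂ => ?_⟩
    simpa only [h₁, h₂, min_self] using main S S hS hS
  · have hE := hρ.isNormalFunctional₃
    have := hE.nontrivial_left
    have := hE.rotate.nontrivial_left
    have := hE.rotate.rotate.nontrivial_left
    have main : ∀ S₁ S₂ S₃ : ℕ, 1 ≤ S₁ → 1 ≤ S₂ → 1 ≤ S₃ →
        (maxViolation₃ ρ S₁ S₂ S₃ : EReal) ≤
          min
            (min (4 * (S₁ : EReal) * S₂ - 2 * ((S₁ : EReal) + S₂) + 1)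
              (min (4 * (S₁ : EReal) * S₃ - 2 * ((S₁ : EReal) + S₃) + 1)
                (4 * (S₂ : EReal) * S₃ - 2 * ((S₂ : EReal) + S₃) + 1)))
            (4 * ENat.toExtReal (prodDivMax (hilbertDim H₁) (hilbertDim H₂) (hilbertDim H₃)) - 3) :=
      fun S₁ S₂ S₃ hS₁ hS₂ hS₃ => by
        simp only [four_mul_sub_two_mul_add_one]
        refine le_min (le_min ?_ (le_min ?_ ?_)) ?_
        · exact maxViolation₃_le hρ hS₁ hS₂ hS₃ (Or.inl ⟨Or.inl rfl, Or.inl rfl⟩)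
        · exact maxViolation₃_le hρ hS₁ hS₂ hS₃ (Or.inr (Or.inl ⟨Or.inl rfl, Or.inl rfl⟩))
        · exact maxViolation₃_le hρ hS₁ hS₂ hS₃ (Or.inr (Or.inr ⟨Or.inl rfl, Or.inl rfl⟩))
        · rcases prodDivMax_choice (hilbertDim H₁) (hilbertDim H₂) (hilbertDim H₃) with h | h | h <;>
            rw [h]
          · exact le_four_mul_toExtReal_mul_sub_three one_le_hilbertDim one_le_hilbertDim
              fun a b ha hb => maxViolation₃_le hρ hS₁ hS₂ hS₃ (Or.inl ⟨Or.inr ha, Or.inr hb⟩)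
          · exact le_four_mul_toExtReal_mul_sub_three one_le_hilbertDim one_le_hilbertDim
              fun a b ha hb =>
                maxViolation₃_le hρ hS₁ hS₂ hS₃ (Or.inr (Or.inl ⟨Or.inr ha, Or.inr hb⟩))
          · exact le_four_mul_toExtReal_mul_sub_three one_le_hilbertDim one_le_hilbertDim
              fun a b ha hb =>
                maxViolation₃_le hρ hS₁ hS₂ hS₃ (Or.inr (Or.inr ⟨Or.inr ha, Or.inr hb⟩))
    have bound : ∀ (S₁ S₂ S₃ : ℕ) (D : ℕ∞), 1 ≤ S₁ → 1 ≤ S₂ → 1 ≤ S₃ →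
        min
            (min (4 * (S₁ : EReal) * S₂ - 2 * ((S₁ : EReal) + S₂) + 1)
              (min (4 * (S₁ : EReal) * S₃ - 2 * ((S₁ : EReal) + S₃) + 1)
                (4 * (S₂ : EReal) * S₃ - 2 * ((S₂ : EReal) + S₃) + 1)))
            (4 * ENat.toExtReal D - 3) ≤
          4 * ENat.toExtReal (min (prodDivMax S₁ S₂ S₃) D) - 3 :=
      fun S₁ S₂ S₃ D hS₁ hS₂ hS₃ => by
        simp only [four_mul_sub_two_mul_add_one]
        rcases min_choice (prodDivMax S₁ S₂ S₃) D with h | h <;> rw [h]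
        · refine (min_le_left _ _).trans ?_
          rcases prodDivMax_choice (S₁ : ℕ∞) S₂ S₃ with h | h | h <;> rw [h]
          · exact (min_le_left _ _).trans (settings_bound_le hS₁ hS₂)
          · exact ((min_le_right _ _).trans (min_le_left _ _)).trans (settings_bound_le hS₁ hS₃)
          · exact ((min_le_right _ _).trans (min_le_right _ _)).trans (settings_bound_le hS₂ hS₃)
        · exact min_le_right _ _
    refine ⟨fun S₁ S₂ S₃ hS₁ hS₂ hS₃ => ⟨main S₁ S₂ S₃ hS₁ hS₂ hS₃, bound S₁ S₂ S₃ _ hS₁ hS₂ hS₃⟩,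
      fun S d hS h₁ h₂ h₃ => ?_⟩
    have hm := main S S S hS hS hS
    have hb := bound S S S (prodDivMax d d d) hS hS hS
    have hsq : ((2 * (S : EReal) - 1) ^ 2)
        = 4 * (S : EReal) * S - 2 * ((S : EReal) + S) + 1 := by
      rw [four_mul_sub_two_mul_add_one, pow_two]
      simp only [EReal.coe_sub, EReal.coe_mul, EReal.coe_natCast]
      rfl
    -- For equal arguments `prodDivMax` is the square, and squaring commutes with the minimum.
    have hmin : min (prodDivMax S S S) (prodDivMax d d d) = min (S : ℕ∞) d * min (S : ℕ∞) d := by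
      simp only [prodDivMax, min_self]
      rcases le_total (S : ℕ∞) d with h | h
      · rw [min_eq_left h, min_eq_left (mul_le_mul' h h)]
      · rw [min_eq_right h, min_eq_right (mul_le_mul' h h)]
    rw [h₁, h₂, h₃] at hm
    rw [hmin] at hb
    simp only [prodDivMax, min_self, ENat.toExtReal_mul] at hm hb
    rw [hsq, pow_two, pow_two]
    exact ⟨hm, hb⟩
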